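/- **Conventions.** Let $\mathcal X$ be a countable (finite or infinite) universe whose elements have distinct names in $\mathbb N$. A database is a finite multiset $D$ over $\mathcal X$, with multiplicities $D[x]$ and size $|D|$; $D,D'$ are neighbors if their multiset symmetric difference has at most one element. A linear query is a function $Q:\mathcal X\to[0,1]$, with $Q(D)=\frac1{|D|}\sum_{x\in D}Q(x)$; it is $m$-sparse if $|\{x:Q(x)>0\}|\le m$. An interactive mechanism holds a database, receives queries $Q_1,\dots,Q_k$ one at a time, and outputs an answer $a_i\in\mathbb R$ to $Q_i$ before receiving $Q_{i+1}$. An adversary chooses each $Q_i$ as a measurable function of $a_1,\dots,a_{i-1}$. The mechanism is $(\epsilon,\delta)$-differentially private if for every adversary, all neighbors $D,D'$ (of any sizes) and every measurable set $S$ of transcripts $(Q_i,a_i)_{i\le k}$, $\Pr[M(D)\in S]\le e^{\epsilon}\Pr[M(D')\in S]+\delta$. It is $(\alpha,\beta)$-accurate on databases of size $n$ if for every $D$ with $|D|=n$ and every adversary, $\Pr[\max_i|Q_i(D)-a_i|\le\alpha]\ge1-\beta$. Running time is counted in steps of a randomized unit-cost real RAM: memory cells hold natural or real numbers and are addressed by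 natural numbers; the unit-cost operations are addition and truncated subtraction of natural numbers, $+,-,\cdot,/,\exp,\log$ on reals, conversion of a natural number to a real, comparisons, memory access, and drawing an independent uniform sample from $[0,1]$. The database is stored as its vector of multiplicities $D[x]$ (addressed by the name of $x$), and a query arrives as a list of the elements $x$ with $Q(x)>0$ together with their values. **Theorem.** There are a program for this machine and absolute constants $C,K>0$, $d\in\mathbb N$ such that the following holds for every universe $\mathcal X$, all $0<\epsilon,\delta,\beta<1$ and all integers $m\ge2$, $k\ge1$, $n\ge1$. Put $$\alpha = C\cdot\frac{(\log m)^{1/4}\left(\log\frac4\delta\,\log\frac k\beta\right)^{1/2}}{(\epsilon n)^{1/2}} .$$ Run with the parameters $\epsilon,\delta,\beta,m,k,n$, the program is an interactive query release mechanism for the class of all $m$-sparse linear queries on $\mathcal X$ that 1. is $(\epsilon,\delta)$-differentially private; 2. is $(\alpha,\beta)$-accurate, on databases of size $n$, for any $k$ adaptively chosen $m$-sparse linear queries; 3. takes time $\tilde O(m/\alpha^2)$ per query, independent of $|\mathcal X|$: for every database, every adversary and every outcome of the random samples, it answers each query within $$K\left(1+\frac m{\alpha^2}\right)\left(1+\log\left(1+\frac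 m{\alpha^2}\right)\right)^{d}$$ steps. -/

import Mathlib

open MeasureTheory

noncomputable section

namespace SparseRelease

/-! ## The machine model: a randomized real RAM with unit-cost steps

The memory consists of arrays of natural numbers and arrays of real numbers, each of them infinite
and addressed by natural numbers. Programs are finite terms of an imperative language; the only
constants are natural numbers. There is no conversion from reals to natural numbers (no rounding),
and there is no multiplication of addresses. Every symbol that is evaluated costs one step. -/

/-- The memory of the machine; `coin` is the position of the next unread random number. -/
structure Mem where
  nat : ℕ → ℕ → ℕ
  real : ℕ → ℕ → ℝ
  coin : ℕ

/-- Expressions with values in the natural numbers; `load a i` is the `i`-th cell of array `a`. -/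
inductive NatExpr where
  | const (c : ℕ)
  | load (a : ℕ) (i : NatExpr)
  | add (e f : NatExpr)
  | sub (e f : NatExpr)

/-- Expressions with values in the real numbers. -/
inductive RealExpr where
  | ofNat (e : NatExpr)
  | load (a : ℕ) (i : NatExpr)
  | add (e f : RealExpr)
  | sub (e f : RealExpr)
  | mul (e f : RealExpr)
  | div (e f : RealExpr)
  | exp (e : RealExpr)
  | log (e : RealExpr)

/-- Tests. -/
inductive Test where
  | natLt (e f : NatExpr)
  | realLt (e f : RealExpr)
  | neg (b : Test)
  | conj (b c : Test)

/-- Programs. `sample a i` stores a fresh uniform random number from `[0,1]` in the `i`-th cell of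
the real array `a`. -/
inductive Prog where
  | skip
  | storeNat (a : ℕ) (i e : NatExpr)
  | storeReal (a : ℕ) (i : NatExpr) (e : RealExpr)
  | sample (a : ℕ) (i : NatExpr)
  | seq (p q : Prog)
  | cond (b : Test) (p q : Prog)
  | loop (b : Test) (p : Prog)

/-- Value of an expression. -/
def NatExpr.eval (s : Mem) : NatExpr → ℕ
  | const c => c
  | load a i => s.nat a (i.eval s)
  | add e f => e.eval s + f.eval s
  | sub e f => e.eval s - f.eval s

/-- Number of symbols of an expression, which is the cost of its evaluation. -/
def NatExpr.cost : NatExpr → ℕ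
  | const _ => 1
  | load _ i => i.cost + 1
  | add e f => e.cost + f.cost + 1
  | sub e f => e.cost + f.cost + 1

/-- Value of an expression. -/
def RealExpr.eval (s : Mem) : RealExpr → ℝ
  | ofNat e => (e.eval s : ℝ)
  | load a i => s.real a (i.eval s)
  | add e f => e.eval s + f.eval s
  | sub e f => e.eval s - f.eval s
  | mul e f => e.eval s * f.eval s
  | div e f => e.eval s / f.eval s
  | exp e => Real.exp (e.eval s)
  | log e => Real.log (e.eval s)

/-- Number of symbols of an expression, which is the cost of its evaluation. -/
def RealExpr.cost : RealExpr → ℕ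
  | ofNat e => e.cost + 1
  | load _ i => i.cost + 1
  | add e f => e.cost + f.cost + 1
  | sub e f => e.cost + f.cost + 1
  | mul e f => e.cost + f.cost + 1
  | div e f => e.cost + f.cost + 1
  | exp e => e.cost + 1
  | log e => e.cost + 1

/-- Truth of a test. -/
def Test.Holds (s : Mem) : Test → Prop
  | natLt e f => e.eval s < f.eval s
  | realLt e f => e.eval s < f.eval s
  | neg b => ¬ b.Holds s
  | conj b c => b.Holds s ∧ c.Holds s

/-- Number of symbols of a test, which is the cost of its evaluation. -/
def Test.cost : Test → ℕ
  | natLt e f => e.cost + f.cost + 1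
  | realLt e f => e.cost + f.cost + 1
  | neg b => b.cost + 1
  | conj b c => b.cost + c.cost + 1

/-- Overwrite one cell of a natural-number array. -/
def Mem.setNat (s : Mem) (a i v : ℕ) : Mem :=
  { s with nat := Function.update s.nat a (Function.update (s.nat a) i v) }

/-- Overwrite one cell of a real array. -/
def Mem.setReal (s : Mem) (a i : ℕ) (v : ℝ) : Mem :=
  { s with real := Function.update s.real a (Function.update (s.real a) i v) }

/-- Store the next random number in a cell of a real array, and advance to the following one. -/
def Mem.draw (ω : ℕ → unitInterval) (s : Mem) (a i : ℕ) : Mem :=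
  { s.setReal a i (ω s.coin : ℝ) with coin := s.coin + 1 }

/-- `Exec ω p s s' t`: started in memory `s` with the random numbers `ω`, the program `p` halts
after exactly `t` steps in memory `s'`. -/
inductive Exec (ω : ℕ → unitInterval) : Prog → Mem → Mem → ℕ → Prop where
  | skip (s : Mem) : Exec ω .skip s s 1
  | storeNat (a : ℕ) (i e : NatExpr) (s : Mem) :
      Exec ω (.storeNat a i e) s (s.setNat a (i.eval s) (e.eval s)) (i.cost + e.cost + 1)
  | storeReal (a : ℕ) (i : NatExpr) (e : RealExpr) (s : Mem) :
      Exec ω (.storeReal a i e) s (s.setReal a (i.eval s) (e.eval s)) (i.cost + e.cost + 1)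
  | sample (a : ℕ) (i : NatExpr) (s : Mem) :
      Exec ω (.sample a i) s (s.draw ω a (i.eval s)) (i.cost + 1)
  | seq {p q : Prog} {s s' s'' : Mem} {t t' : ℕ} :
      Exec ω p s s' t → Exec ω q s' s'' t' → Exec ω (.seq p q) s s'' (t + t' + 1)
  | cond_true {b : Test} {p q : Prog} {s s' : Mem} {t : ℕ} :
      b.Holds s → Exec ω p s s' t → Exec ω (.cond b p q) s s' (b.cost + t + 1)
  | cond_false {b : Test} {p q : Prog} {s s' : Mem} {t : ℕ} :
      ¬ b.Holds s → Exec ω q s s' t → Exec ω (.cond b p q) s s' (b.cost + t + 1)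
  | loop_done {b : Test} {p : Prog} {s : Mem} :
      ¬ b.Holds s → Exec ω (.loop b p) s s (b.cost + 1)
  | loop_step {b : Test} {p : Prog} {s s' s'' : Mem} {t t' : ℕ} :
      b.Holds s → Exec ω p s s' t → Exec ω (.loop b p) s' s'' t' →
      Exec ω (.loop b p) s s'' (b.cost + t + t' + 1)

/-- Execution is deterministic once the random numbers are fixed. -/
theorem Exec.unique {ω : ℕ → unitInterval} {p : Prog} {s s₁ s₂ : Mem} {t₁ t₂ : ℕ}
    (h₁ : Exec ω p s s₁ t₁) (h₂ : Exec ω p s s₂ t₂) : s₁ = s₂ ∧ t₁ = t₂ := by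
  induction h₁ generalizing s₂ t₂ with
  | skip | storeNat | storeReal | sample => cases h₂; exact ⟨rfl, rfl⟩
  | seq _ _ ih ih' =>
    cases h₂ with
    | seq k k' =>
      obtain ⟨rfl, rfl⟩ := ih k
      obtain ⟨rfl, rfl⟩ := ih' k'
      exact ⟨rfl, rfl⟩
  | cond_true hb _ ih =>
    cases h₂ with
    | cond_true _ k => obtain ⟨rfl, rfl⟩ := ih k; exact ⟨rfl, rfl⟩
    | cond_false hb' _ => exact absurd hb hb'
  | cond_false hb _ ih =>
    cases h₂ with
    | cond_true hb' _ => exact absurd hb' hb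
    | cond_false _ k => obtain ⟨rfl, rfl⟩ := ih k; exact ⟨rfl, rfl⟩
  | loop_done hb =>
    cases h₂ with
    | loop_done _ => exact ⟨rfl, rfl⟩
    | loop_step hb' _ _ => exact absurd hb' hb
  | loop_step hb _ _ ih ih' =>
    cases h₂ with
    | loop_done hb' => exact absurd hb hb'
    | loop_step _ k k' =>
      obtain ⟨rfl, rfl⟩ := ih k
      obtain ⟨rfl, rfl⟩ := ih' k'
      exact ⟨rfl, rfl⟩

/-! ## Databases and sparse linear queries -/

section Universe

variable {X : Type*}

/-- Two databases are neighbours if their symmetric difference (as multisets) has at most one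
element. -/
def Neighbors [DecidableEq X] (D D' : Multiset X) : Prop :=
  Multiset.card ((D - D') + (D' - D)) ≤ 1

/-- The sparsity of `Q`, the number of points where it is positive, is at most `m`. -/
def IsSparse (m : ℕ) (Q : X → ℝ) : Prop :=
  {x | 0 < Q x}.encard ≤ m

/-- The value of a linear query on a database: the average over the records. -/
def queryValue (Q : X → ℝ) (D : Multiset X) : ℝ :=
  (D.map Q).sum / (Multiset.card D : ℝ)

variable (X) in
/-- An `m`-sparse linear query `X → [0,1]`, handed over together with a repetition-free enumeration
(in any order) of the universe elements on which it is positive. -/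
structure Query (m : ℕ) where
  toFun : X → ℝ
  mem_Icc : ∀ x, toFun x ∈ Set.Icc (0 : ℝ) 1
  sparse : IsSparse m toFun
  supp : List X
  nodup : supp.Nodup
  mem_supp : ∀ x, x ∈ supp ↔ 0 < toFun x

variable [Encodable X]

/-- The name of the `j`-th enumerated element (`0` beyond the end of the enumeration). -/
def Query.name {m : ℕ} (Q : Query X m) (j : ℕ) : ℕ :=
  (Q.supp.map Encodable.encode).getD j 0

/-- The value of the query at the `j`-th enumerated element (`0` beyond the end). -/
def Query.weight {m : ℕ} (Q : Query X m) (j : ℕ) : ℝ :=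
  (Q.supp.map Q.toFun).getD j 0

/-- The σ-algebra on queries generated by the length of the enumeration, the names and the values
that it lists. -/
instance {m : ℕ} : MeasurableSpace (Query X m) :=
  MeasurableSpace.comap (fun Q => (Q.supp.length, Q.name, Q.weight))
    (inferInstance : MeasurableSpace (ℕ × (ℕ → ℕ) × (ℕ → ℝ)))

/-! ## Interaction with an adaptive adversary -/

variable (X) in
/-- An adaptive adversary: the `i`-th query is a (measurable) function of the answers to the
preceding queries. -/
structure Adversary (m k : ℕ) where
  next : (i : Fin k) → (Fin i → ℝ) → Query X m
  measurable_next : ∀ i, Measurable (next i)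

variable (X) in
/-- Query/answer transcripts of `k` rounds. -/
abbrev Transcript (m k : ℕ) : Type _ := Fin k → Query X m × ℝ

/-- `ω (i, j)` is the `j`-th random number that is available in round `i`. -/
abbrev Coins : Type := ℕ × ℕ → unitInterval

/-- The random numbers are independent and uniformly distributed in `[0,1]`. -/
def coinMeasure : Measure Coins :=
  Measure.infinitePi fun _ : ℕ × ℕ => (volume : Measure unitInterval)

/-- The memory before the first query. The natural-number array `0` is the database as a vector of
multiplicities, addressed by the names of the universe elements; the natural-number array `1` starts
with `m, k, n` and the real array `0` with `ε, δ, β`; every other cell is `0`. -/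
def initMem (ε δ β : ℝ) (m k n : ℕ) (D : Multiset X) : Mem where
  nat a i :=
    if a = 0 then (D.map Encodable.encode).count i
    else if a = 1 then [m, k, n].getD i 0
    else 0
  real a i := if a = 0 then [ε, δ, β].getD i 0 else 0
  coin := 0

/-- Arrival of a query: its enumerated elements are written to the natural-number array `2`, their
number to the first cell of the natural-number array `3`, and the values to the real array `1`. The
rest of the memory is kept, and the random numbers of the new round become available. -/
def Mem.receive {m : ℕ} (s : Mem) (Q : Query X m) : Mem where
  nat a i :=
    if a = 2 then Q.name i
    else if a = 3 ∧ i = 0 then Q.supp.length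
    else s.nat a i
  real a i := if a = 1 then Q.weight i else s.real a i
  coin := 0

/-- The answer is read off the first cell of the real array `2`. -/
def Mem.answer (s : Mem) : ℝ := s.real 2 0

/-- `Runs P ε δ β n D A ω τ tr`: when the program `P`, with the parameters `ε, δ, β, m, k, n`, holds
the database `D`, is run with the random numbers `ω` once for each of the `k` queries that the
adversary `A` asks, it halts within `τ` steps on each of them, and `tr` is the transcript. -/
def Runs {m k : ℕ} (P : Prog) (ε δ β : ℝ) (n : ℕ) (D : Multiset X) (A : Adversary X m k)
    (ω : Coins) (τ : ℝ) (tr : Transcript X m k) : Prop :=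
  ∃ s : ℕ → Mem, s 0 = initMem ε δ β m k n D ∧
    ∀ i : Fin k,
      (tr i).1 = A.next i (fun j => (tr (j.castLE i.isLt.le)).2) ∧
      (∃ t : ℕ, (t : ℝ) ≤ τ ∧
        Exec (fun j => ω (i, j)) P ((s i).receive (tr i).1) (s (i + 1)) t) ∧
      (tr i).2 = (s (i + 1)).answer

/-- `(ε, δ)`-differential privacy of an interactive mechanism: for every adversary and all
neighbouring databases, the distributions of the transcript are `(ε, δ)`-close. -/
def IsPrivate [DecidableEq X] {m k : ℕ} (ε δ : ℝ)
    (M : Multiset X → Adversary X m k → Coins → Transcript X m k) : Prop :=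
  ∀ (A : Adversary X m k) (D D' : Multiset X), Neighbors D D' →
    ∀ S : Set (Transcript X m k), MeasurableSet S →
      coinMeasure {ω | M D A ω ∈ S} ≤
        ENNReal.ofReal (Real.exp ε) * coinMeasure {ω | M D' A ω ∈ S} + ENNReal.ofReal δ

/-- `(α, β)`-accuracy on databases of size `n`: for every adversary, with probability at least
`1 - β` all answers are within `α` of the value of the query. -/
def IsAccurate {m k : ℕ} (n : ℕ) (α β : ℝ)
    (M : Multiset X → Adversary X m k → Coins → Transcript X m k) : Prop :=
  ∀ (A : Adversary X m k) (D : Multiset X), Multiset.card D = n →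
    ENNReal.ofReal (1 - β) ≤
      coinMeasure {ω | ∀ i, |queryValue (M D A ω i).1.toFun D - (M D A ω i).2| ≤ α}

end Universe

end SparseRelease

end

/-! The mechanism is multiplicative weights with a lazily grown, unnormalised hypothesis `hyp`,
which vanishes outside the finite set `T` of names inserted so far. Each query undergoes two tests
with Laplace noise. The first estimates the database mass on the listed elements outside `T`; if the
estimate `v` is noticeable, these elements enter `T`, each with weight `v / m`. The second compares
a noisy answer with the answer of the hypothesis. If they agree up to `α / 2`, the hypothesis
answers; otherwise the noisy answer is released and the listed weights are multiplied by
exponentials.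

Accuracy does not see the size of the universe because of the potential in `Config.Invariant`: the
unnormalised relative entropy of the database with respect to the hypothesis, restricted to `T`.
Inserting mass `μ` raises it by about `μ * log (2 m)`, since no new element carries more than `2 v`.
The inserted masses sum to at most 1, so only `O(log m)` entropy is ever supplied. A reweighing
removes at least `α ^ 2 / 128` (`Invariant.reweigh`), and an insertion involves mass of order at
least `α`, which pays for being counted (`Invariant.insertNew`). Hence, while the noise is small,
there are `O(log m / α ^ 2)` updates and the budget is never exhausted.

Privacy is paid for only by updates. A test whose uncharged outcome is almost certain has almost no
privacy loss: its loss moments are proportional to the probability `P` of a charged outcome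
(`sum_exp_log_ratio_le_one`). So `exp (c * loss + τ * W)`, where `W` counts the charged outcomes
still allowed, is a supermartingale for `τ` of order `(c * s) ^ 2`, with `s` the loss bound of one
test. A Markov argument with `c = log (4 / δ) / ε` then gives `(ε, δ)`-privacy (`Tests.value_le`) as
soon as `(c * s) ^ 2` times the budget is a small constant. With noise scale `α / (128 log (k / β))`
this condition is a lower bound on `α ^ 4`, which is where the fourth root of `log m` comes from.

Noisy values are rounded up to multiples of `α / 16` and cut off just beyond 1. A test therefore has
finitely many outcomes, which makes its law a finite recursion, and the machine, which cannot round,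
finds the multiple in `O(1 / α)` loop steps. The other loops run over the at most `m` listed
elements. Simulation lemmas (`halts_main`, `runs_main`) identify the program with the sequence of
tests for every value of the coins. If `α ≥ 1`, answering 0 is already accurate and the database is
not touched. -/

namespace SparseRelease

noncomputable section

/-! ## Laplace noise from a uniform sample -/

/-- The inverse distribution function of the Laplace distribution. -/
def lap (u : ℝ) : ℝ := if u < 1 / 2 then Real.log (2 * u) else -Real.log (2 - 2 * u)

theorem measurable_lap : Measurable lap :=
  Measurable.ite measurableSet_Iio (by fun_prop) (by fun_prop)

theorem measurable_lap_coe : Measurable fun u : unitInterval => lap u :=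
  measurable_lap.comp measurable_subtype_coe

/-- The Laplace distribution. -/
def laplaceMeasure : Measure ℝ :=
  volume.withDensity fun x => ENNReal.ofReal (Real.exp (-|x|) / 2)

theorem laplaceMeasure_Iic_of_nonpos {x : ℝ} (hx : x ≤ 0) :
    laplaceMeasure (Set.Iic x) = ENNReal.ofReal (Real.exp x / 2) := by
  have h : Set.EqOn (fun t : ℝ => Real.exp (-|t|) / 2) (fun t => Real.exp t / 2) (Set.Iic x) := by
    intro t ht
    simp [abs_of_nonpos (le_trans (Set.mem_Iic.1 ht) hx)]
  have hi : IntegrableOn (fun t : ℝ => Real.exp t / 2) (Set.Iic x) :=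
    (integrableOn_exp_Iic x).div_const 2
  rw [laplaceMeasure, withDensity_apply _ measurableSet_Iic,
    ← ofReal_integral_eq_lintegral_ofReal
      ((integrableOn_congr_fun h measurableSet_Iic).2 hi)
      (Filter.Eventually.of_forall fun t => by positivity),
    setIntegral_congr_fun measurableSet_Iic h, integral_div, integral_exp_Iic]

theorem laplaceMeasure_Ioi_of_nonneg {x : ℝ} (hx : 0 ≤ x) :
    laplaceMeasure (Set.Ioi x) = ENNReal.ofReal (Real.exp (-x) / 2) := by
  have h : Set.EqOn (fun t : ℝ => Real.exp (-|t|) / 2) (fun t => Real.exp (-t) / 2)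
      (Set.Ioi x) := by
    intro t ht
    simp [abs_of_nonneg (le_trans hx (Set.mem_Ioi.1 ht).le)]
  have hi : IntegrableOn (fun t : ℝ => Real.exp (-t) / 2) (Set.Ioi x) :=
    (integrableOn_exp_neg_Ioi x).div_const 2
  rw [laplaceMeasure, withDensity_apply _ measurableSet_Ioi,
    ← ofReal_integral_eq_lintegral_ofReal
      ((integrableOn_congr_fun h measurableSet_Ioi).2 hi)
      (Filter.Eventually.of_forall fun t => by positivity),
    setIntegral_congr_fun measurableSet_Ioi h, integral_div, integral_exp_neg_Ioi]

instance : IsProbabilityMeasure laplaceMeasure := by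
  constructor
  rw [← Set.Iic_union_Ioi (a := (0 : ℝ)),
    measure_union (Set.Iic_disjoint_Ioi le_rfl) measurableSet_Ioi,
    laplaceMeasure_Iic_of_nonpos le_rfl, laplaceMeasure_Ioi_of_nonneg le_rfl,
    ← ENNReal.ofReal_add (by positivity) (by positivity)]
  norm_num

theorem laplaceMeasure_Iic_of_nonneg {x : ℝ} (hx : 0 ≤ x) :
    laplaceMeasure (Set.Iic x) = ENNReal.ofReal (1 - Real.exp (-x) / 2) := by
  rw [← compl_compl (Set.Iic x), Set.compl_Iic, prob_compl_eq_one_sub measurableSet_Ioi,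
    laplaceMeasure_Ioi_of_nonneg hx, ENNReal.ofReal_sub _ (by positivity), ENNReal.ofReal_one]

/-- Since `Real.log 0 = 0`, both `lap 0` and `lap 1` are 0. So the endpoint 0 must be excluded here,
and the endpoint 1 added in the nonnegative case; both are null sets. -/
theorem lap_le_iff_of_neg {x : ℝ} (hx : x < 0) (u : unitInterval) :
    lap u ≤ x ↔ 0 < (u : ℝ) ∧ (u : ℝ) ≤ Real.exp x / 2 := by
  have h0 := u.2.1
  have h1 := u.2.2
  have hx1 : Real.exp x < 1 := by simpa using Real.exp_lt_exp.2 hx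
  unfold lap
  split_ifs with h
  · rcases h0.eq_or_lt with h0 | h0
    · simp [← h0, hx]
    · rw [Real.log_le_iff_le_exp (by linarith)]
      constructor
      · intro h; exact ⟨h0, by linarith⟩
      · intro h; linarith [h.2]
  · have : Real.log (2 - 2 * u) ≤ 0 := Real.log_nonpos (by linarith) (by linarith)
    constructor
    · intro h; linarith
    · intro h; linarith [h.2]

theorem lap_le_iff_of_nonneg {x : ℝ} (hx : 0 ≤ x) (u : unitInterval) :
    lap u ≤ x ↔ (u : ℝ) = 1 ∨ (u : ℝ) ≤ 1 - Real.exp (-x) / 2 := by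
  have h0 := u.2.1
  have h1 := u.2.2
  have hx1 : Real.exp (-x) ≤ 1 := Real.exp_le_one_iff.2 (by linarith)
  unfold lap
  split_ifs with h
  · have : Real.log (2 * u) ≤ 0 := Real.log_nonpos (by linarith) (by linarith)
    constructor
    · intro _; right; linarith
    · intro _; linarith
  · rcases h1.eq_or_lt with h1 | h1
    · simp [h1, hx]
    · rw [neg_le, Real.le_log_iff_exp_le (by linarith)]
      constructor
      · intro h; right; linarith
      · rintro (h | h) <;> linarith

theorem map_lap :
    (volume : Measure unitInterval).map (fun u : unitInterval => lap u) = laplaceMeasure := by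
  have hm := measurable_lap_coe
  have := Measure.isProbabilityMeasure_map (μ := (volume : Measure unitInterval)) hm.aemeasurable
  refine Measure.ext_of_Iic _ _ fun x => ?_
  rw [Measure.map_apply hm measurableSet_Iic]
  rcases lt_or_ge x 0 with hx | hx
  · rw [laplaceMeasure_Iic_of_nonpos hx.le]
    have hx1 : Real.exp x < 1 := by simpa using Real.exp_lt_exp.2 hx
    have hx0 := Real.exp_pos x
    have : (fun u : unitInterval => lap u) ⁻¹' Set.Iic x
        = Set.Ioc 0 ⟨Real.exp x / 2, by constructor <;> linarith⟩ := by
      ext u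
      simp only [Set.mem_preimage, Set.mem_Iic, lap_le_iff_of_neg hx, Set.mem_Ioc,
        ← Subtype.coe_lt_coe, ← Subtype.coe_le_coe, Set.Icc.coe_zero]
    rw [this, unitInterval.volume_Ioc]
    simp
  · rw [laplaceMeasure_Iic_of_nonneg hx]
    have hx1 : Real.exp (-x) ≤ 1 := Real.exp_le_one_iff.2 (by linarith)
    have hx0 := Real.exp_pos (-x)
    have : (fun u : unitInterval => lap u) ⁻¹' Set.Iic x
        = {1} ∪ Set.Iic ⟨1 - Real.exp (-x) / 2, by constructor <;> linarith⟩ := by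
      ext u
      simp only [Set.mem_preimage, Set.mem_Iic, lap_le_iff_of_nonneg hx, Set.mem_union,
        Set.mem_singleton_iff, ← Subtype.coe_le_coe, Subtype.ext_iff]
      rfl
    rw [this, ← unitInterval.volume_Iic ⟨1 - Real.exp (-x) / 2, by constructor <;> linarith⟩]
    refine le_antisymm ((measure_union_le _ _).trans ?_) (measure_mono Set.subset_union_right)
    rw [measure_singleton, zero_add]

/-- Translating the integration variable by `(v' - v) / b` turns one event into the other, and the
Laplace density changes by at most the stated factor. -/
theorem lap_shift_le {b : ℝ} (hb : 0 < b) (v v' : ℝ) {E : Set ℝ} (hE : MeasurableSet E) :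
    (volume : Measure unitInterval) {u | v + b * lap u ∈ E} ≤
      ENNReal.ofReal (Real.exp (|v - v'| / b)) *
        (volume : Measure unitInterval) {u | v' + b * lap u ∈ E} := by
  have key : ∀ w : ℝ, (volume : Measure unitInterval) {u | w + b * lap u ∈ E} =
      ∫⁻ x, E.indicator 1 (w + b * x) * ENNReal.ofReal (Real.exp (-|x|) / 2) := by
    intro w
    have hm : MeasurableSet {x : ℝ | w + b * x ∈ E} :=
      (show Measurable fun x : ℝ => w + b * x by fun_prop) hE
    have h1 : (volume : Measure unitInterval) {u | w + b * lap u ∈ E}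
        = laplaceMeasure {x : ℝ | w + b * x ∈ E} := by
      rw [← map_lap, Measure.map_apply measurable_lap_coe hm]
      rfl
    rw [h1, laplaceMeasure, withDensity_apply _ hm, ← lintegral_indicator hm]
    congr 1 with x
    by_cases h : w + b * x ∈ E <;> simp [Set.indicator, h]
  rw [key v, key v', ← lintegral_add_right_eq_self _ ((v' - v) / b),
    ← lintegral_const_mul' _ _ ENNReal.ofReal_ne_top]
  refine lintegral_mono fun x => ?_
  have e : v + b * (x + (v' - v) / b) = v' + b * x := by field_simp; ring
  rw [e, mul_left_comm]
  gcongr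
  rw [← ENNReal.ofReal_mul (Real.exp_pos _).le, mul_div_assoc', ← Real.exp_add]
  refine ENNReal.ofReal_le_ofReal ?_
  gcongr
  have h2 : |(v' - v) / b| = |v - v'| / b := by rw [abs_div, abs_of_pos hb, abs_sub_comm]
  have h3 : |x| ≤ |x + (v' - v) / b| + |(v' - v) / b| := by
    simpa using abs_sub (x + (v' - v) / b) ((v' - v) / b)
  linarith

theorem lap_tail {t : ℝ} (ht : 0 ≤ t) :
    (volume : Measure unitInterval) {u | t < |lap u|} ≤ ENNReal.ofReal (Real.exp (-t)) := by
  have hm : MeasurableSet {x : ℝ | t < |x|} := measurableSet_lt measurable_const (by fun_prop)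
  have h1 : (volume : Measure unitInterval) {u | t < |lap u|}
      = laplaceMeasure {x : ℝ | t < |x|} := by
    rw [← map_lap, Measure.map_apply measurable_lap_coe hm]
    rfl
  have h2 : {x : ℝ | t < |x|} ⊆ Set.Iic (-t) ∪ Set.Ioi t := by
    intro x hx
    rcases lt_abs.1 (Set.mem_ofPred.1 hx) with h | h
    · exact Or.inr h
    · left; simp only [Set.mem_Iic]; linarith
  rw [h1]
  refine (measure_mono h2).trans ((measure_union_le _ _).trans ?_)
  rw [laplaceMeasure_Iic_of_nonpos (by linarith), laplaceMeasure_Ioi_of_nonneg ht,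
    ← ENNReal.ofReal_add (by positivity) (by positivity)]
  simp

/-! ## Privacy of adaptively chosen noisy tests with few charged outcomes -/

theorem exp_le_quadratic {x : ℝ} (hx : |x| ≤ 1) : Real.exp x ≤ 1 + x + x ^ 2 := by
  linarith [(abs_le.1 (Real.abs_exp_sub_one_sub_id_le hx)).2]

theorem abs_exp_sub_one_le_two_mul {x s : ℝ} (hs : s ≤ 1) (hx : |x| ≤ s) :
    |Real.exp x - 1| ≤ 2 * s := by
  have h1 : |x| ≤ 1 := hx.trans hs
  have h2 := abs_le.1 (Real.abs_exp_sub_one_sub_id_le h1)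
  have h3 : x ^ 2 ≤ s := by
    rw [← sq_abs]; nlinarith [abs_nonneg x]
  have h4 := abs_le.1 hx
  have h5 := Real.add_one_le_exp x
  rw [abs_le]; constructor <;> linarith

/-- One step of the privacy supermartingale: `p`, `p'` are the outcome laws on neighbouring
databases, `l` is the loss, and outcome 0 is free. The free outcome changes its probability only by
`P' - P = O(s * P)`, so its loss is controlled by the charged mass `P`. The first-order terms of
free and charged outcomes cancel, what remains is at most `12 * (c * s) ^ 2 * P`, and the discount
on charged outcomes compensates exactly this amount. -/
theorem sum_exp_log_ratio_le_one {J : ℕ} {p p' l : ℕ → ℝ} {s c : ℝ}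
    (hp : ∀ o, 0 ≤ p o)
    (hsum : ∑ o ∈ Finset.range (J + 1), p o = 1) (hsum' : ∑ o ∈ Finset.range (J + 1), p' o = 1)
    (hl : ∀ o, p o = p' o * Real.exp (l o)) (hls : ∀ o, |l o| ≤ s) (hc : 1 ≤ c)
    (hcs : 144 * (c * s) ^ 2 ≤ 1) :
    ∑ o ∈ Finset.range (J + 1), p o * (Real.exp (c * l o) *
      if o = 0 then 1 else Real.exp (-(72 * (c * s) ^ 2))) ≤ 1 := by
  have hs0 : 0 ≤ s := (abs_nonneg _).trans (hls 0)
  have hu0 : 0 ≤ c * s := by positivity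
  have hu : c * s ≤ 1 / 12 := by nlinarith
  have hsu : s ≤ c * s := by nlinarith
  have hs1 : s ≤ 1 := by linarith
  rw [Finset.sum_range_succ'] at hsum hsum' ⊢
  simp only [Nat.add_eq_zero_iff, one_ne_zero, and_false, if_false, if_true, mul_one]
  set P := ∑ i ∈ Finset.range J, p (i + 1) with hP
  set P' := ∑ i ∈ Finset.range J, p' (i + 1) with hP'
  have hP0 : 0 ≤ P := Finset.sum_nonneg fun i _ => hp _
  have hinv : ∀ o, p' o = p o * Real.exp (-l o) := fun o => by
    rw [hl o, mul_assoc, ← Real.exp_add]; simp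
  have hlsq : ∀ o, l o ^ 2 ≤ s ^ 2 := fun o => by
    rw [← sq_abs]; exact pow_le_pow_left₀ (abs_nonneg _) (hls o) 2
  have hcl : ∀ o, |c * l o| ≤ c * s := fun o => by
    rw [abs_mul, abs_of_nonneg (by linarith : 0 ≤ c)]
    exact mul_le_mul_of_nonneg_left (hls o) (by linarith)
  have hexp : ∀ o, Real.exp (c * l o) ≤ 1 + c * l o + c ^ 2 * l o ^ 2 := fun o => by
    have := exp_le_quadratic ((hcl o).trans (by linarith))
    rwa [mul_pow] at this
  have F1 : |P' - P| ≤ 2 * s * P := by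
    rw [hP, hP', ← Finset.sum_sub_distrib, Finset.mul_sum]
    refine (Finset.abs_sum_le_sum_abs _ _).trans (Finset.sum_le_sum fun i _ => ?_)
    rw [hinv, ← mul_sub_one, abs_mul, abs_of_nonneg (hp _), mul_comm]
    exact mul_le_mul_of_nonneg_right
      (abs_exp_sub_one_le_two_mul hs1 (by rw [abs_neg]; exact hls _)) (hp _)
  -- From `p' = p * exp (-l) ≤ p * (1 - l + l ^ 2)`. The term `P - P'` cancels against the one in
  -- `F3`.
  have F2 : ∑ i ∈ Finset.range J, p (i + 1) * l (i + 1) ≤ P - P' + s ^ 2 * P := by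
    rw [hP, hP', Finset.mul_sum, ← Finset.sum_sub_distrib, ← Finset.sum_add_distrib]
    refine Finset.sum_le_sum fun i _ => ?_
    have h1 := exp_le_quadratic (x := -l (i + 1)) (by rw [abs_neg]; exact (hls _).trans hs1)
    rw [hinv (i + 1)]
    linarith [mul_le_mul_of_nonneg_left h1 (hp (i + 1)),
      mul_le_mul_of_nonneg_left (hlsq (i + 1)) (hp (i + 1))]
  have F1' := abs_le.1 F1
  set r := Real.exp (l 0) with hr
  have hr1 := abs_le.1 (abs_exp_sub_one_le_two_mul hs1 (hls 0))
  have hpr : p' 0 * (r - 1) = P' - P := by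
    rw [mul_sub_one, ← hl 0]; linarith
  -- Since `p 0 = r * p' 0`, the bound `l 0 ≤ r - 1` becomes `r * (P' - P)`; replacing `r` by 1
  -- costs only a term of order `s ^ 2 * P`.
  have hle : p 0 * l 0 ≤ r * (P' - P) := by
    have h1 : l 0 ≤ r - 1 := by linarith [Real.add_one_le_exp (l 0)]
    calc p 0 * l 0 ≤ p 0 * (r - 1) := mul_le_mul_of_nonneg_left h1 (hp 0)
      _ = r * (P' - P) := by rw [← hpr, hl 0]; ring
  have hsP : 0 ≤ s * P := by positivity
  have F3 : p 0 * l 0 ≤ P' - P + 4 * s ^ 2 * P := by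
    have h1 : (r - 1) * (P' - P) ≤ 2 * s * (2 * s * P) := by
      refine (le_abs_self _).trans ?_
      rw [abs_mul]
      exact mul_le_mul (abs_le.2 hr1) F1 (abs_nonneg _) (by positivity)
    nlinarith
  have F4 : p 0 * l 0 ^ 2 ≤ 6 * s ^ 2 * P := by
    have h0 := abs_le.1 (hls 0)
    rcases le_total 0 (l 0) with h | h
    · have h1 : r * (P' - P) ≤ 3 * (2 * s * P) := by
        have hr0 : 0 ≤ r := (Real.exp_pos _).le
        calc r * (P' - P) ≤ r * (2 * s * P) := mul_le_mul_of_nonneg_left F1'.2 hr0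
          _ ≤ 3 * (2 * s * P) := mul_le_mul_of_nonneg_right (by linarith) (by positivity)
      have h2 : p 0 * l 0 * l 0 ≤ 3 * (2 * s * P) * s :=
        mul_le_mul (hle.trans h1) h0.2 h (by positivity)
      nlinarith
    · have h1 : -l 0 ≤ Real.exp (-l 0) - 1 := by linarith [Real.add_one_le_exp (-l 0)]
      have h2 : p 0 * (-l 0) ≤ 2 * s * P := by
        calc p 0 * (-l 0) ≤ p 0 * (Real.exp (-l 0) - 1) := mul_le_mul_of_nonneg_left h1 (hp 0)
          _ = P - P' := by rw [mul_sub_one, ← hinv 0]; linarith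
          _ ≤ 2 * s * P := by linarith
      have h3 : p 0 * (-l 0) * (-l 0) ≤ (2 * s * P) * s :=
        mul_le_mul h2 (by linarith) (by linarith) (by positivity)
      nlinarith
  have Z0 : p 0 * Real.exp (c * l 0) ≤ p 0 + c * (p 0 * l 0) + c ^ 2 * (p 0 * l 0 ^ 2) := by
    linarith [mul_le_mul_of_nonneg_left (hexp 0) (hp 0)]
  set Z := ∑ i ∈ Finset.range J, p (i + 1) * Real.exp (c * l (i + 1)) with hZ
  have Z1 : Z ≤ P + c * ∑ i ∈ Finset.range J, p (i + 1) * l (i + 1) + c ^ 2 * s ^ 2 * P := by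
    rw [hZ, hP, Finset.mul_sum, Finset.mul_sum, ← Finset.sum_add_distrib,
      ← Finset.sum_add_distrib]
    refine Finset.sum_le_sum fun i _ => ?_
    have h1 := mul_le_mul_of_nonneg_left (hexp (i + 1)) (hp (i + 1))
    have h2 := mul_le_mul_of_nonneg_left (mul_le_mul_of_nonneg_left (hlsq (i + 1))
      (sq_nonneg c)) (hp (i + 1))
    linarith
  -- Crude, but enough: the discount saves `36 * (c * s) ^ 2 * Z`, hence at least `12 * (c * s) ^ 2
  -- * P`. The expenses are `5 + 7`: the mean contributes `1 + 4` by `F2` and `F3`, the square `6 +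
  -- 1` by `F4` and `Z1`.
  have Z2 : P / 3 ≤ Z := by
    rw [hZ, hP, Finset.sum_div]
    refine Finset.sum_le_sum fun i _ => ?_
    have h1 := Real.add_one_le_exp (c * l (i + 1))
    have h2 := (abs_le.1 (hcl (i + 1))).1
    have h3 : (1 / 3 : ℝ) ≤ Real.exp (c * l (i + 1)) := by linarith
    linarith [mul_le_mul_of_nonneg_left h3 (hp (i + 1))]
  have hZs : ∑ i ∈ Finset.range J, p (i + 1) *
      (Real.exp (c * l (i + 1)) * Real.exp (-(72 * (c * s) ^ 2))) =
      Z * Real.exp (-(72 * (c * s) ^ 2)) := by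
    rw [hZ, Finset.sum_mul]; simp only [mul_assoc]
  rw [hZs]
  -- The exponent is at most `1 / 2` in absolute value, so `exp (-τ) ≤ 1 - τ + τ ^ 2 ≤ 1 - τ / 2`.
  have hτ : Real.exp (-(72 * (c * s) ^ 2)) ≤ 1 - 36 * (c * s) ^ 2 := by
    have h1 := exp_le_quadratic (x := -(72 * (c * s) ^ 2))
      (by rw [abs_neg, abs_of_nonneg (by positivity)]; linarith)
    nlinarith [sq_nonneg (c * s)]
  have hZ0 : 0 ≤ Z := le_trans (by positivity) Z2
  have e1 : Z * Real.exp (-(72 * (c * s) ^ 2)) ≤ Z - 36 * (c * s) ^ 2 * Z := by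
    linarith [mul_le_mul_of_nonneg_left hτ hZ0]
  have e2 : 36 * (c * s) ^ 2 * (P / 3) ≤ 36 * (c * s) ^ 2 * Z :=
    mul_le_mul_of_nonneg_left Z2 (by positivity)
  have e3 : c * s ^ 2 * P ≤ (c * s) ^ 2 * P := by
    refine mul_le_mul_of_nonneg_right ?_ hP0
    nlinarith
  have e4 : c * (p 0 * l 0) ≤ c * (P' - P + 4 * s ^ 2 * P) :=
    mul_le_mul_of_nonneg_left F3 (by linarith)
  have e5 := mul_le_mul_of_nonneg_left F2 (by linarith : 0 ≤ c)
  have e6 := mul_le_mul_of_nonneg_left F4 (sq_nonneg c)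
  linarith

/-- An adaptive sequence of noisy tests: in state `σ`, the `t`-th test perturbs a statistic by
Laplace noise of scale `scale`, reports the outcome `out t σ` of the noisy value, and continues
with the state `next t σ` of that outcome. -/
structure Tests (St : Type*) where
  scale : ℝ
  bound : ℕ
  out : ℕ → St → ℝ → ℕ
  next : ℕ → St → ℕ → St
  scale_pos : 0 < scale
  measurable_out : ∀ t σ, Measurable (out t σ)
  out_le : ∀ t σ z, out t σ z ≤ bound

/-- The uniform sample of the `t`-th test. -/
def coin (t : ℕ) (ω : Coins) : unitInterval := ω (t / 2, t % 2)

namespace Tests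

variable {St : Type*} (T : Tests St)

/-- The state after `n` tests from time `t` on. -/
def run (val : ℕ → St → ℝ) (ω : Coins) : ℕ → ℕ → St → St
  | 0, _, σ => σ
  | n + 1, t, σ =>
    run val ω n (t + 1) (T.next t σ (T.out t σ (val t σ + T.scale * lap (coin t ω))))

theorem run_succ (val : ℕ → St → ℝ) (ω : Coins) (n t : ℕ) (σ : St) :
    T.run val ω (n + 1) t σ = T.next (t + n) (T.run val ω n t σ)
      (T.out (t + n) (T.run val ω n t σ)
        (val (t + n) (T.run val ω n t σ) + T.scale * lap (coin (t + n) ω))) := by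
  induction n generalizing t σ with
  | zero => rfl
  | succ n ih =>
    rw [run, ih, run]
    simp only [add_assoc, add_comm 1 n]

/-- The event of an outcome. -/
def event (val : ℕ → St → ℝ) (t : ℕ) (σ : St) (o : ℕ) : Set unitInterval :=
  {u | val t σ + T.scale * lap u ∈ T.out t σ ⁻¹' {o}}

theorem measurableSet_event (val : ℕ → St → ℝ) (t : ℕ) (σ : St) (o : ℕ) :
    MeasurableSet (T.event val t σ o) :=
  ((measurable_lap_coe.const_mul T.scale).const_add (val t σ))
    (T.measurable_out t σ (measurableSet_singleton o))

/-- The probability of an outcome. -/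
def prob (val : ℕ → St → ℝ) (t : ℕ) (σ : St) (o : ℕ) : ℝ :=
  (volume : Measure unitInterval).real (T.event val t σ o)

/-- The probability that the state after `n` tests lies in `F`. -/
def value (val : ℕ → St → ℝ) (F : Set St) : ℕ → ℕ → St → ℝ
  | 0, _, σ => F.indicator 1 σ
  | n + 1, t, σ => ∑ o ∈ Finset.range (T.bound + 1),
      T.prob val t σ o * value val F n (t + 1) (T.next t σ o)

theorem prob_nonneg (val : ℕ → St → ℝ) (t : ℕ) (σ : St) (o : ℕ) : 0 ≤ T.prob val t σ o :=
  measureReal_nonneg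

theorem sum_prob (val : ℕ → St → ℝ) (t : ℕ) (σ : St) :
    ∑ o ∈ Finset.range (T.bound + 1), T.prob val t σ o = 1 := by
  unfold prob
  rw [← measureReal_biUnion_finset]
  · rw [← probReal_univ (μ := (volume : Measure unitInterval))]
    congr 1
    refine Set.eq_univ_of_forall fun u => ?_
    simp only [Set.mem_iUnion, Finset.mem_range, exists_prop, event]
    exact ⟨_, Nat.lt_succ_of_le (T.out_le t σ _), rfl⟩
  · intro i _ j _ hij
    refine Set.disjoint_left.2 fun u hi hj => hij ?_
    exact (show T.out t σ _ = i from hi).symm.trans hj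
  · exact fun o _ => T.measurableSet_event val t σ o

theorem value_nonneg (val : ℕ → St → ℝ) (F : Set St) (n t : ℕ) (σ : St) :
    0 ≤ T.value val F n t σ := by
  induction n generalizing t σ with
  | zero => exact Set.indicator_nonneg (fun _ _ => zero_le_one) _
  | succ n ih => exact Finset.sum_nonneg fun o _ => mul_nonneg (T.prob_nonneg _ _ _ _) (ih _ _)

theorem prob_le_exp_mul {val val' : ℕ → St → ℝ} {Δ : ℝ}
    (hΔ : ∀ t σ, |val t σ - val' t σ| ≤ Δ) (t : ℕ) (σ : St) (o : ℕ) :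
    T.prob val t σ o ≤ Real.exp (Δ / T.scale) * T.prob val' t σ o := by
  have h := lap_shift_le T.scale_pos (val t σ) (val' t σ)
    (T.measurable_out t σ (measurableSet_singleton o))
  have h2 := ENNReal.toReal_mono (by finiteness) h
  rw [ENNReal.toReal_mul, ENNReal.toReal_ofReal (Real.exp_pos _).le] at h2
  refine h2.trans (mul_le_mul_of_nonneg_right ?_ measureReal_nonneg)
  rw [Real.exp_le_exp]
  exact div_le_div_of_nonneg_right (hΔ t σ) T.scale_pos.le

theorem exists_log_ratio {p q s : ℝ} (hp : 0 ≤ p) (hq : 0 ≤ q) (hs : 0 ≤ s)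
    (hpq : p ≤ Real.exp s * q) (hqp : q ≤ Real.exp s * p) :
    ∃ l : ℝ, p = q * Real.exp l ∧ |l| ≤ s := by
  rcases hp.eq_or_lt with rfl | hp
  · have : q = 0 := le_antisymm (by simpa using hqp) hq
    exact ⟨0, by simp [this], by simpa using hs⟩
  have hq : 0 < q := by
    rcases hq.eq_or_lt with rfl | hq
    · simp at hpq; linarith
    · exact hq
  refine ⟨Real.log (p / q), ?_, ?_⟩
  · rw [Real.exp_log (by positivity)]; field_simp
  · rw [abs_le]
    constructor
    · rw [Real.le_log_iff_exp_le (by positivity), Real.exp_neg, le_div_iff₀ hq,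
        inv_mul_le_iff₀ (Real.exp_pos _)]
      exact hqp
    · rw [Real.log_le_iff_le_exp (by positivity), div_le_iff₀ hq]
      exact hpq

/-- Here `L` is the privacy loss accumulated before time `t`. Histories that end with loss at most
`ε` are covered by the first summand; the second is the exponential Markov bound for the others,
with `W` limiting the future charges. Carrying `L` through the induction avoids a separate treatment
of the bad event. -/
theorem value_le {val val' : ℕ → St → ℝ} {Δ ε c : ℝ} {W : St → ℝ}
    (hΔ : ∀ t σ, |val t σ - val' t σ| ≤ Δ) (hc : 1 ≤ c)
    (hcs : 144 * (c * (Δ / T.scale)) ^ 2 ≤ 1) (hW : ∀ σ, 0 ≤ W σ)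
    (hfree : ∀ t σ, W (T.next t σ 0) ≤ W σ)
    (hcharge : ∀ t σ z, T.out t σ z ≠ 0 → W (T.next t σ (T.out t σ z)) + 1 ≤ W σ)
    (F : Set St) (n t : ℕ) (σ : St) (L : ℝ) :
    T.value val F n t σ ≤ Real.exp (ε - L) * T.value val' F n t σ +
      Real.exp (c * (L - ε)) * Real.exp (72 * (c * (Δ / T.scale)) ^ 2 * W σ) := by
  induction n generalizing t σ L with
  | zero =>
    simp only [value]
    have h2 : 0 ≤ 72 * (c * (Δ / T.scale)) ^ 2 * W σ := mul_nonneg (by positivity) (hW σ)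
    have h3 : 1 ≤ Real.exp (72 * (c * (Δ / T.scale)) ^ 2 * W σ) := Real.one_le_exp h2
    by_cases hσ : σ ∈ F
    · simp only [Set.indicator_of_mem hσ, Pi.one_apply, mul_one]
      -- At the end, the first summand is at least 1 if `L ≤ ε`, and the second one is otherwise.
      rcases le_total L ε with h | h
      · have : 1 ≤ Real.exp (ε - L) := Real.one_le_exp (by linarith)
        have : 0 ≤ Real.exp (c * (L - ε)) *
          Real.exp (72 * (c * (Δ / T.scale)) ^ 2 * W σ) := by positivity
        linarith
      · have h1 : 1 ≤ Real.exp (c * (L - ε)) :=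
          Real.one_le_exp (mul_nonneg (by linarith) (by linarith))
        nlinarith [Real.exp_pos (ε - L)]
    · simp only [Set.indicator_of_notMem hσ, mul_zero, zero_add]
      positivity
  | succ n ih =>
    set s := Δ / T.scale with hs
    have hs0 : 0 ≤ s := div_nonneg ((abs_nonneg _).trans (hΔ t σ)) T.scale_pos.le
    have hΔ' : ∀ t σ, |val' t σ - val t σ| ≤ Δ := fun t σ => by rw [abs_sub_comm]; exact hΔ t σ
    have hex : ∀ o, ∃ l : ℝ, T.prob val t σ o = T.prob val' t σ o * Real.exp l ∧ |l| ≤ s :=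
      fun o => exists_log_ratio (T.prob_nonneg _ _ _ _) (T.prob_nonneg _ _ _ _) hs0
        (T.prob_le_exp_mul hΔ t σ o) (T.prob_le_exp_mul hΔ' t σ o)
    choose l hl hls using hex
    have key := sum_exp_log_ratio_le_one (T.prob_nonneg val t σ)
      (T.sum_prob val t σ) (T.sum_prob val' t σ) hl hls hc hcs
    simp only [value]
    set τ := 72 * (c * s) ^ 2 with hτ
    have hτ0 : 0 ≤ τ := by positivity
    calc ∑ o ∈ Finset.range (T.bound + 1),
          T.prob val t σ o * T.value val F n (t + 1) (T.next t σ o)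
        ≤ ∑ o ∈ Finset.range (T.bound + 1),
          (Real.exp (ε - L) * (T.prob val' t σ o * T.value val' F n (t + 1) (T.next t σ o)) +
          (Real.exp (c * (L - ε)) * Real.exp (τ * W σ)) *
          (T.prob val t σ o * (Real.exp (c * l o) * if o = 0 then 1 else Real.exp (-τ)))) := by
          refine Finset.sum_le_sum fun o _ => ?_
          -- The charge condition speaks only of outcomes that are attained, so outcomes of
          -- probability 0 are split off; positive probability provides a sample attaining `o`.
          rcases (T.prob_nonneg val t σ o).eq_or_lt with h0 | h0
          · rw [← h0]
            have := T.prob_nonneg val' t σ o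
            have := T.value_nonneg val' F n (t + 1) (T.next t σ o)
            simp only [zero_mul, mul_zero, add_zero]
            positivity
          · have hWo : Real.exp (τ * W (T.next t σ o)) ≤
                Real.exp (τ * W σ) * if o = 0 then 1 else Real.exp (-τ) := by
              split_ifs with ho
              · rw [mul_one, ho, Real.exp_le_exp]
                exact mul_le_mul_of_nonneg_left (hfree t σ) hτ0
              · have hne : (T.event val t σ o).Nonempty := by
                  by_contra hcon
                  rw [Set.not_nonempty_iff_eq_empty] at hcon
                  simp [prob, hcon] at h0
                obtain ⟨u, hu⟩ := hne
                have hu : T.out t σ (val t σ + T.scale * lap u) = o := hu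
                have h1 := hcharge t σ _ (by rw [hu]; exact ho)
                rw [hu] at h1
                rw [← Real.exp_add, Real.exp_le_exp]
                nlinarith
            -- The loss grows by `l o`; the factor `exp (-l o)` then converts the probability under
            -- `val` into the one under `val'`.
            have h1 := mul_le_mul_of_nonneg_left (ih (t + 1) (T.next t σ o) (L + l o)) h0.le
            refine h1.trans ?_
            rw [mul_add]
            refine add_le_add (le_of_eq ?_) ?_
            · rw [hl o, show ε - L = (ε - (L + l o)) + l o by ring, Real.exp_add]; ring
            · rw [show c * (L + l o - ε) = c * (L - ε) + c * l o by ring, Real.exp_add]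
              calc _ = (T.prob val t σ o * Real.exp (c * (L - ε)) * Real.exp (c * l o)) *
                      Real.exp (τ * W (T.next t σ o)) := by ring
                _ ≤ (T.prob val t σ o * Real.exp (c * (L - ε)) * Real.exp (c * l o)) *
                      (Real.exp (τ * W σ) * if o = 0 then 1 else Real.exp (-τ)) := by
                    gcongr
                _ = _ := by ring
      _ ≤ _ := by
          rw [Finset.sum_add_distrib, ← Finset.mul_sum, ← Finset.mul_sum]
          have h1 : 0 ≤ Real.exp (c * (L - ε)) * Real.exp (τ * W σ) := by positivity
          linarith [mul_le_mul_of_nonneg_left key h1]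

end Tests

/-! ### The law of a run of tests under independent coins -/

instance : IsProbabilityMeasure coinMeasure := by unfold coinMeasure; infer_instance

theorem measurable_coin (t : ℕ) : Measurable (coin t) := measurable_pi_apply _

theorem map_coin (t : ℕ) : coinMeasure.map (coin t) = volume :=
  (measurePreserving_eval_infinitePi (fun _ : ℕ × ℕ => (volume : Measure unitInterval))
    (t / 2, t % 2)).map_eq

theorem iIndepFun_coin : ProbabilityTheory.iIndepFun coin coinMeasure := by
  have h := ProbabilityTheory.iIndepFun_infinitePi
    (P := fun _ : ℕ × ℕ => (volume : Measure unitInterval)) (X := fun _ u => u)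
    (fun _ => measurable_id)
  refine h.precomp (g := fun t : ℕ => (t / 2, t % 2)) fun a b hab => ?_
  simp only [Prod.mk.injEq] at hab
  omega

namespace Tests

variable {St : Type*} (T : Tests St)

/-- The σ-algebra of the samples from time `t` on. -/
abbrev future (t : ℕ) : MeasurableSpace Coins :=
  ⨆ j ∈ Set.Ici t, MeasurableSpace.comap (coin j) inferInstance

theorem future_le (t : ℕ) : future t ≤ MeasurableSpace.pi :=
  iSup₂_le fun j _ => (measurable_coin j).comap_le

theorem run_mem_eq (val : ℕ → St → ℝ) (F : Set St) (n t : ℕ) (σ : St) :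
    {ω | T.run val ω (n + 1) t σ ∈ F} = ⋃ o ∈ Finset.range (T.bound + 1),
      coin t ⁻¹' T.event val t σ o ∩ {ω | T.run val ω n (t + 1) (T.next t σ o) ∈ F} := by
  ext ω
  simp only [Set.mem_ofPred_eq, run, Set.mem_iUnion, Finset.mem_range, exists_prop, Set.mem_inter_iff]
  constructor
  · intro h
    exact ⟨_, Nat.lt_succ_of_le (T.out_le t σ _), rfl, h⟩
  · rintro ⟨o, _, ho, h⟩
    have ho : T.out t σ (val t σ + T.scale * lap (coin t ω)) = o := ho
    rwa [ho]

/-- Every set `F` of states is allowed, because the run depends on the coins only through finitely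
many discrete outcomes. -/
theorem measurableSet_run_future (val : ℕ → St → ℝ) (F : Set St) (n t : ℕ) (σ : St) :
    MeasurableSet[future t] {ω | T.run val ω n t σ ∈ F} := by
  induction n generalizing t σ with
  | zero => by_cases h : σ ∈ F <;> simp [run, h]
  | succ n ih =>
    rw [run_mem_eq]
    refine Finset.measurableSet_biUnion _ fun o _ => MeasurableSet.inter ?_ ?_
    · have h : MeasurableSpace.comap (coin t) inferInstance ≤ future t :=
        le_iSup₂_of_le t (Set.mem_Ici.2 le_rfl) le_rfl
      exact h _ ⟨_, T.measurableSet_event val t σ o, rfl⟩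
    · have h : future (t + 1) ≤ future t :=
        biSup_mono fun j hj => Set.mem_Ici.2 (Nat.le_of_succ_le hj)
      exact h _ (ih _ _)

theorem measurableSet_run (val : ℕ → St → ℝ) (F : Set St) (n t : ℕ) (σ : St) :
    MeasurableSet {ω | T.run val ω n t σ ∈ F} :=
  future_le t _ (T.measurableSet_run_future val F n t σ)

/-- The outcome at time `t` uses only the coin `t`, and the rest of the run only later coins;
independence turns the decomposition by outcomes into the recursion defining `value`. -/
theorem coinMeasure_run (val : ℕ → St → ℝ) (F : Set St) (n t : ℕ) (σ : St) :
    coinMeasure.real {ω | T.run val ω n t σ ∈ F} = T.value val F n t σ := by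
  induction n generalizing t σ with
  | zero => by_cases h : σ ∈ F <;> simp [run, value, h]
  | succ n ih =>
    rw [run_mem_eq, measureReal_biUnion_finset]
    · refine Finset.sum_congr rfl fun o _ => ?_
      have hind := ProbabilityTheory.indep_iSup_of_disjoint
        (fun j => (measurable_coin j).comap_le) iIndepFun_coin.iIndep
        (S := {t}) (T := Set.Ici (t + 1)) (by simp)
      rw [ProbabilityTheory.Indep_iff] at hind
      have hE := T.measurableSet_event val t σ o
      have h1 := hind (coin t ⁻¹' T.event val t σ o)
        {ω | T.run val ω n (t + 1) (T.next t σ o) ∈ F}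
        ((le_iSup₂_of_le (f := fun j (_ : j ∈ ({t} : Set ℕ)) =>
          MeasurableSpace.comap (coin j) inferInstance) t rfl le_rfl) _ ⟨_, hE, rfl⟩)
        (T.measurableSet_run_future val F n (t + 1) (T.next t σ o))
      rw [measureReal_def, h1, ENNReal.toReal_mul, ← measureReal_def, ← measureReal_def, ih,
        prob, ← map_coin t, map_measureReal_apply (measurable_coin t) hE]
    · intro i _ j _ hij
      refine Set.disjoint_left.2 fun ω hi hj => hij ?_
      exact (show T.out t σ _ = i from hi.1).symm.trans hj.1
    · exact fun o _ => (measurable_coin t (T.measurableSet_event val t σ o)).inter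
        (T.measurableSet_run val F n (t + 1) _)

/-- The case `L = 0`, `c = log (4 / δ) / ε` of `value_le`: the Markov term is `δ / 4` times the
exponential of a number at most 1, and `e < 4`. -/
theorem coinMeasure_run_le {val val' : ℕ → St → ℝ} {Δ ε δ : ℝ} {W : St → ℝ} {σ : St}
    (hΔ : ∀ t σ, |val t σ - val' t σ| ≤ Δ) (hε : 0 < ε) (hε1 : ε < 1) (hδ : 0 < δ) (hδ1 : δ < 1)
    (hs : 144 * (Real.log (4 / δ) / ε * (Δ / T.scale)) ^ 2 ≤ 1)
    (hsW : 72 * (Real.log (4 / δ) / ε * (Δ / T.scale)) ^ 2 * W σ ≤ 1)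
    (hW : ∀ σ, 0 ≤ W σ) (hfree : ∀ t σ, W (T.next t σ 0) ≤ W σ)
    (hcharge : ∀ t σ z, T.out t σ z ≠ 0 → W (T.next t σ (T.out t σ z)) + 1 ≤ W σ)
    (F : Set St) (n : ℕ) :
    coinMeasure {ω | T.run val ω n 0 σ ∈ F} ≤
      ENNReal.ofReal (Real.exp ε) * coinMeasure {ω | T.run val' ω n 0 σ ∈ F} +
        ENNReal.ofReal δ := by
  have hlog : 1 ≤ Real.log (4 / δ) := by
    rw [Real.le_log_iff_exp_le (by positivity), le_div_iff₀ hδ]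
    nlinarith [Real.exp_one_lt_d9, Real.exp_pos 1]
  have hc : 1 ≤ Real.log (4 / δ) / ε := by rw [le_div_iff₀ hε]; linarith
  have h := T.value_le (ε := ε) hΔ hc hs hW hfree hcharge F n 0 σ 0
  rw [← coinMeasure_run, ← coinMeasure_run, sub_zero, zero_sub,
    show Real.log (4 / δ) / ε * -ε = -Real.log (4 / δ) by field_simp, Real.exp_neg,
    Real.exp_log (by positivity), inv_div] at h
  have h2 : δ / 4 * Real.exp (72 * (Real.log (4 / δ) / ε * (Δ / T.scale)) ^ 2 * W σ) ≤ δ := by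
    have h3 := Real.exp_le_exp.2 hsW
    have h4 := Real.exp_one_lt_d9
    nlinarith
  rw [← ENNReal.toReal_le_toReal (by finiteness) (by finiteness),
    ENNReal.toReal_add (by finiteness) (by finiteness), ENNReal.toReal_mul,
    ENNReal.toReal_ofReal (Real.exp_pos _).le, ENNReal.toReal_ofReal hδ.le,
    ← measureReal_def, ← measureReal_def]
  linarith

end Tests

/-! ## The mechanism on the level of numbers -/

/-- A query as it is seen by the machine. -/
structure RawQuery where
  len : ℕ
  name : ℕ → ℕ
  weight : ℕ → ℝ

/-- Validity of a query as it is seen by the machine: the names are distinct, and the values lie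
in the unit interval. -/
structure RawQuery.Valid (q : RawQuery) (m : ℕ) : Prop where
  len_le : q.len ≤ m
  injOn : Set.InjOn q.name (Set.Iio q.len)
  weight_nonneg : ∀ j, 0 ≤ q.weight j
  weight_le : ∀ j, q.weight j ≤ 1

/-- The parameters of the mechanism. -/
structure Config where
  α : ℝ
  scale : ℝ
  m : ℕ
  n : ℕ
  α_pos : 0 < α
  scale_pos : 0 < scale

/-- The public state of the mechanism: the hypothesis, the number of updates of the hypothesis, and
the answers given so far. -/
structure State where
  hyp : ℕ → ℝ
  updates : ℕ
  answers : ℕ → ℝ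

/-- Give weight `v` to those among the first `j` names that have no weight yet. -/
def insertNew (name : ℕ → ℕ) (v : ℝ) (h : ℕ → ℝ) : ℕ → ℕ → ℝ
  | 0 => h
  | j + 1 =>
    if 0 < insertNew name v h j (name j) then insertNew name v h j
    else Function.update (insertNew name v h j) (name j) v

/-- The multiplicative weights update on the first `j` names. -/
def reweigh (name : ℕ → ℕ) (w : ℕ → ℝ) (η : ℝ) (h : ℕ → ℝ) : ℕ → ℕ → ℝ
  | 0 => h
  | j + 1 =>
    Function.update (reweigh name w η h j) (name j)
      (reweigh name w η h j (name j) * Real.exp (η * w j))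

/-- The number of records of `d` at elements in the support of `q` that have no weight in `h`. -/
def RawQuery.newMass (q : RawQuery) (h : ℕ → ℝ) (d : ℕ → ℕ) : ℝ :=
  ∑ j ∈ Finset.range q.len, if 0 < h (q.name j) then 0 else (d (q.name j) : ℝ)

/-- The sum of the query over the records of `d`. -/
def RawQuery.total (q : RawQuery) (d : ℕ → ℕ) : ℝ :=
  ∑ j ∈ Finset.range q.len, d (q.name j) * q.weight j

/-- The value of the query on the hypothesis `h`. -/
def RawQuery.onHyp (q : RawQuery) (h : ℕ → ℝ) : ℝ :=
  ∑ j ∈ Finset.range q.len, h (q.name j) * q.weight j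

namespace Config

variable (c : Config)

/-- The number of updates after which the mechanism gives up. -/
def budget : ℝ := 2048 * Real.log c.m / (c.α * c.α)

/-- Whether the mechanism looks at the database. -/
def Active (σ : State) : Prop := c.α < 1 ∧ (σ.updates : ℝ) < c.budget

/-- Rounding up to a positive multiple of `α / 16`, stopping at the first multiple beyond `1`. -/
def quant (z : ℝ) : ℕ := max 1 ⌈min z 1 / (c.α / 16)⌉₊

theorem measurable_quant : Measurable c.quant := by
  unfold quant
  exact measurable_const.max (Nat.measurable_ceil.comp (by fun_prop))

theorem quant_le (z : ℝ) : c.quant z ≤ max 1 ⌈1 / (c.α / 16)⌉₊ := by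
  have := c.α_pos
  unfold quant
  gcongr
  exact min_le_right _ _

theorem quant_pos (z : ℝ) : 0 < c.quant z := lt_max_of_lt_left one_pos

/-- The multiple of `α / 16` with index `p`. -/
def level (p : ℕ) : ℝ := p * (c.α / 16)

open Classical in
/-- The mechanism as a sequence of noisy tests, two for each query: the first one looks for mass on
elements without weight, the second one compares the query on the database with its value on the
hypothesis. -/
def tests (query : ℕ → (ℕ → ℝ) → RawQuery) : Tests State where
  scale := c.scale
  bound := max 1 ⌈1 / (c.α / 16)⌉₊
  out t σ z :=
    if c.Active σ then
      if t % 2 = 0 then if c.quant z = 1 then 0 else c.quant z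
      else if |c.level (c.quant z) - (query (t / 2) σ.answers).onHyp σ.hyp| ≤ c.α / 2 then 0
      else c.quant z
    else 0
  next t σ o :=
    let q := query (t / 2) σ.answers
    if t % 2 = 0 then
      if o = 0 then σ
      else ⟨insertNew q.name (c.level o / c.m) σ.hyp q.len, σ.updates + 1, σ.answers⟩
    else if c.Active σ then
      if o = 0 then ⟨σ.hyp, σ.updates, Function.update σ.answers (t / 2) (q.onHyp σ.hyp)⟩
      else ⟨reweigh q.name q.weight
          (if q.onHyp σ.hyp < c.level o then c.α / 8 else -(c.α / 8)) σ.hyp q.len,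
        σ.updates + 1, Function.update σ.answers (t / 2) (c.level o)⟩
    else ⟨σ.hyp, σ.updates, Function.update σ.answers (t / 2) 0⟩
  scale_pos := c.scale_pos
  measurable_out t σ := by
    have hq := c.measurable_quant
    refine Measurable.ite (MeasurableSet.const _) (Measurable.ite (MeasurableSet.const _) ?_ ?_)
      measurable_const
    · exact (measurable_of_countable fun p : ℕ => if p = 1 then 0 else p).comp hq
    · exact (measurable_of_countable fun p : ℕ =>
        if |c.level p - (query (t / 2) σ.answers).onHyp σ.hyp| ≤ c.α / 2 then 0 else p).comp hq
  out_le t σ z := by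
    have := c.quant_le z
    split_ifs <;> first | exact Nat.zero_le _ | exact this

/-- The statistic of the database that is perturbed in a test. -/
def val (query : ℕ → (ℕ → ℝ) → RawQuery) (d : ℕ → ℕ) (t : ℕ) (σ : State) : ℝ :=
  if t % 2 = 0 then (query (t / 2) σ.answers).newMass σ.hyp d / c.n
  else (query (t / 2) σ.answers).total d / c.n

/-- The state before the first query. -/
def start : State := ⟨fun _ => 0, 0, fun _ => 0⟩

/-- The number of charged outcomes that are still possible. -/
def left (σ : State) : ℝ := max (c.budget + 1 - σ.updates) 0

theorem left_next_zero (query : ℕ → (ℕ → ℝ) → RawQuery) (t : ℕ) (σ : State) :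
    c.left ((c.tests query).next t σ 0) ≤ c.left σ := by
  simp only [tests, left, if_true]
  split_ifs <;> rfl

theorem left_next_add_one (query : ℕ → (ℕ → ℝ) → RawQuery) (t : ℕ) (σ : State) (z : ℝ)
    (h : (c.tests query).out t σ z ≠ 0) :
    c.left ((c.tests query).next t σ ((c.tests query).out t σ z)) + 1 ≤ c.left σ := by
  have hact : c.Active σ := by
    by_contra hcon
    exact h (by simp [tests, hcon])
  have hu : ((c.tests query).next t σ ((c.tests query).out t σ z)).updates = σ.updates + 1 := by
    generalize (c.tests query).out t σ z = o at h
    simp only [tests, hact, h, if_true, if_false]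
    split_ifs <;> rfl
  -- Being active means `updates < budget`; the `+ 1` in `left` keeps it nonnegative even after the
  -- last permitted charge, so the truncation at 0 plays no role.
  have h2 := hact.2
  rw [left, left, hu, max_eq_left, max_eq_left] <;> push_cast <;> linarith

end Config

/-! ## Sensitivity -/

theorem sum_count_le_card {ι : Type*} [DecidableEq ι] (s : Finset ι) (R : Multiset ι) :
    ∑ i ∈ s, R.count i ≤ Multiset.card R := by
  induction R using Multiset.induction with
  | empty => simp
  | cons a R ih =>
    simp only [Multiset.count_cons, Finset.sum_add_distrib, Multiset.card_cons]
    refine add_le_add ih ?_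
    rw [Finset.sum_ite_eq']
    split_ifs <;> simp

theorem Neighbors.exists_add {X : Type*} [DecidableEq X] {D D' : Multiset X}
    (h : Neighbors D D') :
    ∃ R : Multiset X, Multiset.card R ≤ 1 ∧ (D' = D + R ∨ D = D' + R) := by
  unfold Neighbors at h
  rw [Multiset.card_add] at h
  by_cases h0 : Multiset.card (D - D') = 0
  · refine ⟨D' - D, by omega, Or.inl ?_⟩
    rw [Multiset.card_eq_zero, tsub_eq_zero_iff_le] at h0
    exact (add_tsub_cancel_of_le h0).symm
  · have h1 : Multiset.card (D' - D) = 0 := by omega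
    refine ⟨D - D', by omega, Or.inr ?_⟩
    rw [Multiset.card_eq_zero, tsub_eq_zero_iff_le] at h1
    exact (add_tsub_cancel_of_le h1).symm

/-- The vector of multiplicities of a database. -/
def counts {X : Type*} [Encodable X] (D : Multiset X) (i : ℕ) : ℕ :=
  (D.map Encodable.encode).count i

theorem counts_add {X : Type*} [Encodable X] (D R : Multiset X) (i : ℕ) :
    counts (D + R) i = counts D i + counts R i := by
  simp [counts]

/-- Distinctness of the names is what prevents a record from being counted twice. -/
theorem RawQuery.Valid.sum_counts_le {X : Type*} [Encodable X] {q : RawQuery} {m : ℕ}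
    (hq : q.Valid m) (R : Multiset X) :
    ∑ j ∈ Finset.range q.len, (counts R (q.name j) : ℝ) ≤ Multiset.card R := by
  rw [← Nat.cast_sum, Nat.cast_le]
  have h : Set.InjOn q.name (Finset.range q.len) := by
    simpa using hq.injOn
  rw [← Finset.sum_image (f := fun i => counts R i) h]
  exact (sum_count_le_card _ _).trans (by simp)

theorem RawQuery.Valid.abs_sum_sub_le {X : Type*} [Encodable X] [DecidableEq X] {q : RawQuery}
    {m : ℕ} (hq : q.Valid m) {a : ℕ → ℝ} (ha : ∀ j, 0 ≤ a j) (ha' : ∀ j, a j ≤ 1)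
    {D D' : Multiset X} (h : Neighbors D D') :
    |∑ j ∈ Finset.range q.len, counts D (q.name j) * a j -
      ∑ j ∈ Finset.range q.len, counts D' (q.name j) * a j| ≤ 1 := by
  obtain ⟨R, hR, h⟩ := h.exists_add
  have h0 : 0 ≤ ∑ j ∈ Finset.range q.len, counts R (q.name j) * a j :=
    Finset.sum_nonneg fun j _ => mul_nonneg (Nat.cast_nonneg _) (ha j)
  have h1 : ∑ j ∈ Finset.range q.len, counts R (q.name j) * a j ≤ 1 := by
    calc _ ≤ ∑ j ∈ Finset.range q.len, (counts R (q.name j) : ℝ) :=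
          Finset.sum_le_sum fun j _ => mul_le_of_le_one_right (Nat.cast_nonneg _) (ha' j)
      _ ≤ (Multiset.card R : ℝ) := hq.sum_counts_le R
      _ ≤ 1 := by exact_mod_cast hR
  rcases h with rfl | rfl <;>
  · simp only [counts_add, Nat.cast_add, add_mul, Finset.sum_add_distrib]
    rw [abs_le]
    constructor <;> linarith

theorem RawQuery.newMass_eq (q : RawQuery) (h : ℕ → ℝ) (d : ℕ → ℕ) :
    q.newMass h d = ∑ j ∈ Finset.range q.len,
      (d (q.name j) : ℝ) * if 0 < h (q.name j) then 0 else 1 := by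
  refine Finset.sum_congr rfl fun j _ => ?_
  split_ifs <;> simp

namespace Config

variable (c : Config) {X : Type*} [Encodable X] [DecidableEq X]
  {query : ℕ → (ℕ → ℝ) → RawQuery}

/-- The statistics are divided by the public parameter `n`, not by the size of the database held, so
the bound is valid for neighbours of different sizes. -/
theorem abs_val_sub_le (hq : ∀ i a, (query i a).Valid c.m) {D D' : Multiset X}
    (h : Neighbors D D') (t : ℕ) (σ : State) :
    |c.val query (counts D) t σ - c.val query (counts D') t σ| ≤ 1 / c.n := by
  have hv := hq (t / 2) σ.answers
  unfold val
  split_ifs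
  · rw [← sub_div, abs_div, abs_of_nonneg (Nat.cast_nonneg c.n : (0 : ℝ) ≤ c.n),
      RawQuery.newMass_eq, RawQuery.newMass_eq]
    gcongr
    exact hv.abs_sum_sub_le (fun j => by split_ifs <;> norm_num)
      (fun j => by split_ifs <;> norm_num) h
  · rw [← sub_div, abs_div, abs_of_nonneg (Nat.cast_nonneg c.n : (0 : ℝ) ≤ c.n)]
    gcongr
    exact hv.abs_sum_sub_le hv.weight_nonneg hv.weight_le h

end Config

/-! ### Queries as the machine sees them, and privacy of the mechanism -/

section Queries

variable {X : Type*} [Encodable X] {m k : ℕ}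

/-- A query as it is seen by the machine. -/
def Query.raw (Q : Query X m) : RawQuery := ⟨Q.supp.length, Q.name, Q.weight⟩

theorem Query.raw_valid (Q : Query X m) : Q.raw.Valid m where
  len_le := by
    have h := Q.sparse
    have hs : {x | 0 < Q.toFun x} = {x | x ∈ Q.supp} := by ext x; exact (Q.mem_supp x).symm
    classical
    rw [IsSparse, hs, ← List.coe_toFinset, Set.encard_coe_eq_coe_finsetCard,
      List.toFinset_card_of_nodup Q.nodup] at h
    exact_mod_cast h
  injOn := by
    intro i hi j hj hij
    simp only [Query.raw, Set.mem_Iio] at hi hj hij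
    have hn : (Q.supp.map Encodable.encode).Nodup := Q.nodup.map Encodable.encode_injective
    simp only [Query.name] at hij
    rw [List.getD_eq_getElem _ _ (by simpa using hi), List.getD_eq_getElem _ _ (by simpa using hj)]
      at hij
    exact (hn.getElem_inj_iff).1 hij
  weight_nonneg j := by
    simp only [Query.raw, Query.weight]
    rcases lt_or_ge j (Q.supp.map Q.toFun).length with h | h
    · rw [List.getD_eq_getElem _ _ h, List.getElem_map]
      exact (Q.mem_Icc _).1
    · rw [List.getD_eq_default _ _ h]
  weight_le j := by
    simp only [Query.raw, Query.weight]
    rcases lt_or_ge j (Q.supp.map Q.toFun).length with h | h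
    · rw [List.getD_eq_getElem _ _ h, List.getElem_map]
      exact (Q.mem_Icc _).2
    · rw [List.getD_eq_default _ _ h]; exact zero_le_one

/-- The queries of an adversary as a function of the sequence of answers. -/
def Adversary.strategy (A : Adversary X m k) (i : ℕ) (a : ℕ → ℝ) : RawQuery :=
  if h : i < k then (A.next ⟨i, h⟩ fun j => a j).raw else ⟨0, fun _ => 0, fun _ => 0⟩

theorem Adversary.strategy_valid (A : Adversary X m k) (i : ℕ) (a : ℕ → ℝ) :
    (A.strategy i a).Valid m := by
  unfold strategy
  split_ifs
  · exact Query.raw_valid _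
  · exact ⟨Nat.zero_le _, fun i hi => absurd hi (Nat.not_lt_zero i), fun _ => le_rfl,
      fun _ => zero_le_one⟩

/-- The transcript of queries and answers with given answers. -/
def Adversary.transcript (A : Adversary X m k) (a : ℕ → ℝ) : Transcript X m k :=
  fun i => (A.next i fun j => a j, a i)

/-- The mechanism that runs the tests. -/
def Config.mechanism (c : Config) (D : Multiset X) (A : Adversary X m k) (ω : Coins) :
    Transcript X m k :=
  A.transcript ((c.tests A.strategy).run (c.val A.strategy (counts D)) ω (2 * k) 0 start).answers

/-- The transcript factors through the final state of the run, and every set of final states is an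
event. -/
theorem Config.measurable_mechanism (c : Config) (D : Multiset X) (A : Adversary X m k) :
    Measurable (c.mechanism D A) := fun S _ =>
  (c.tests A.strategy).measurableSet_run (c.val A.strategy (counts D))
    {σ | A.transcript σ.answers ∈ S} (2 * k) 0 start

/-- The transcript is a function of the final state that does not involve the database, so it
suffices that the final state is private, with `left` as the count of charges. -/
theorem Config.isPrivate_mechanism [DecidableEq X] (c : Config) (hm : c.m = m) {ε δ : ℝ}
    (hε : 0 < ε) (hε1 : ε < 1) (hδ : 0 < δ) (hδ1 : δ < 1)
    (hs : 144 * (Real.log (4 / δ) / ε * (1 / c.n / c.scale)) ^ 2 ≤ 1)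
    (hsW : 72 * (Real.log (4 / δ) / ε * (1 / c.n / c.scale)) ^ 2 * (c.budget + 1) ≤ 1) :
    IsPrivate ε δ (c.mechanism (X := X) (m := m) (k := k)) := by
  intro A D D' h S _
  have hleft : c.left start ≤ max (c.budget + 1) 0 := by simp [left, start]
  refine (c.tests A.strategy).coinMeasure_run_le (W := c.left) (Δ := 1 / c.n)
    (c.abs_val_sub_le (fun i a => hm ▸ A.strategy_valid i a) h) hε hε1 hδ hδ1 hs ?_
    (fun σ => le_max_right _ _) (c.left_next_zero _) (c.left_next_add_one _)
    {σ | A.transcript σ.answers ∈ S} (2 * k)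
  have h0 : 0 ≤ 72 * (Real.log (4 / δ) / ε * (1 / c.n / c.scale)) ^ 2 := by positivity
  refine (mul_le_mul_of_nonneg_left hleft h0).trans ?_
  rw [mul_max_of_nonneg _ _ h0, mul_zero]
  exact max_le hsW zero_le_one

end Queries

/-! ## Reasoning about programs -/

/-- Started in memory `s`, the program `p` halts within `τ` steps in a memory that satisfies
`Q`. -/
def Halts (ω : ℕ → unitInterval) (p : Prog) (s : Mem) (Q : Mem → Prop) (τ : ℕ) : Prop :=
  ∃ s' t, Exec ω p s s' t ∧ Q s' ∧ t ≤ τ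

section Rules

variable {ω : ℕ → unitInterval} {s : Mem} {p q : Prog} {Q R : Mem → Prop} {b : Test}

theorem Halts.mono {τ τ' : ℕ} (h : Halts ω p s Q τ) (hQ : ∀ s', Q s' → R s') (hτ : τ ≤ τ') :
    Halts ω p s R τ' := by
  obtain ⟨s', t, he, hq, ht⟩ := h
  exact ⟨s', t, he, hQ _ hq, ht.trans hτ⟩

theorem halts_skip (h : Q s) : Halts ω .skip s Q 1 := ⟨s, 1, .skip s, h, le_rfl⟩

theorem halts_storeNat {a : ℕ} {i e : NatExpr} (h : Q (s.setNat a (i.eval s) (e.eval s))) :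
    Halts ω (.storeNat a i e) s Q (i.cost + e.cost + 1) := ⟨_, _, .storeNat a i e s, h, le_rfl⟩

theorem halts_storeReal {a : ℕ} {i : NatExpr} {e : RealExpr}
    (h : Q (s.setReal a (i.eval s) (e.eval s))) :
    Halts ω (.storeReal a i e) s Q (i.cost + e.cost + 1) := ⟨_, _, .storeReal a i e s, h, le_rfl⟩

theorem halts_sample {a : ℕ} {i : NatExpr} (h : Q (s.draw ω a (i.eval s))) :
    Halts ω (.sample a i) s Q (i.cost + 1) := ⟨_, _, .sample a i s, h, le_rfl⟩

theorem Halts.seq {τ τ' : ℕ} (h : Halts ω p s Q τ) (h' : ∀ s', Q s' → Halts ω q s' R τ') :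
    Halts ω (.seq p q) s R (τ + τ' + 1) := by
  obtain ⟨s', t, he, hq, ht⟩ := h
  obtain ⟨s'', t', he', hq', ht'⟩ := h' s' hq
  exact ⟨s'', _, .seq he he', hq', by omega⟩

theorem halts_cond {τ τ' : ℕ} (h : b.Holds s → Halts ω p s Q τ)
    (h' : ¬ b.Holds s → Halts ω q s Q τ') : Halts ω (.cond b p q) s Q (b.cost + max τ τ' + 1) := by
  by_cases hb : b.Holds s
  · obtain ⟨s', t, he, hq, ht⟩ := h hb
    exact ⟨s', _, .cond_true hb he, hq, by omega⟩
  · obtain ⟨s', t, he, hq, ht⟩ := h' hb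
    exact ⟨s', _, .cond_false hb he, hq, by omega⟩

theorem halts_loop {I : ℕ → Mem → Prop} {N τ : ℕ}
    (hstep : ∀ j < N, ∀ s, I j s → b.Holds s ∧ Halts ω p s (I (j + 1)) τ)
    (hend : ∀ s, I N s → ¬ b.Holds s) (h : I 0 s) :
    Halts ω (.loop b p) s (I N) (N * (τ + b.cost + 1) + b.cost + 1) := by
  suffices H : ∀ r j, j + r = N → ∀ s, I j s →
      Halts ω (.loop b p) s (I N) (r * (τ + b.cost + 1) + b.cost + 1) from H N 0 (by simp) s h
  intro r
  induction r with
  | zero =>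
    intro j hj s hs
    obtain rfl : j = N := by simpa using hj
    exact ⟨s, _, .loop_done (hend s hs), hs, by simp⟩
  | succ r ih =>
    intro j hj s hs
    obtain ⟨hb, s', t, he, hI, ht⟩ := hstep j (by omega) s hs
    obtain ⟨s'', t', he', hI', ht'⟩ := ih (j + 1) (by omega) s' hI
    exact ⟨s'', _, .loop_step hb he he', hI', by rw [Nat.succ_mul]; omega⟩

end Rules

/-! ## The program -/

namespace Program

/-- The first cell of an array of natural numbers. -/
abbrev nat (a : ℕ) : NatExpr := .load a (.const 0)

/-- The first cell of a real array. -/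
abbrev real (a : ℕ) : RealExpr := .load a (.const 0)

/-- A real constant. -/
abbrev num (c : ℕ) : RealExpr := .ofNat (.const c)

/-- The name that the counter of a loop points at. -/
abbrev name : NatExpr := .load 2 (nat 5)

/-- The weight that the counter of a loop points at. -/
abbrev weight : RealExpr := .load 1 (nat 5)

/-- A loop over the enumerated elements of the query. -/
def forNames (p : Prog) : Prog :=
  .seq (.storeNat 5 (.const 0) (.const 0))
    (.loop (.natLt (nat 5) (nat 3)) (.seq p (.storeNat 5 (.const 0) (.add (nat 5) (.const 1)))))

/-- The accuracy of the mechanism. -/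
def accuracy : RealExpr :=
  .mul (num 1000) (.exp (.add (.div (.log (.log (.ofNat (nat 1)))) (num 4))
    (.div (.sub (.add (.log (.log (.div (num 4) (.load 0 (.const 1)))))
      (.log (.log (.div (.ofNat (.load 1 (.const 1))) (.load 0 (.const 2))))))
      (.log (.mul (real 0) (.ofNat (.load 1 (.const 2)))))) (num 2))))

/-- The scale of the noise. -/
def scale : RealExpr :=
  .div (real 5) (.mul (num 128) (.log (.div (.ofNat (.load 1 (.const 1))) (.load 0 (.const 2)))))

/-- The bound on the number of updates. -/
def budget : RealExpr :=
  .div (.mul (num 2048) (.log (.ofNat (nat 1)))) (.mul (real 5) (real 5))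

/-- Perturb the count in the real array `8`, normalised by the size. -/
def noise : Prog :=
  .seq (.sample 12 (.const 0))
    (.cond (.realLt (real 12) (.div (num 1) (num 2)))
      (.storeReal 10 (.const 0) (.add (.div (real 8) (.ofNat (.load 1 (.const 2))))
        (.mul (real 6) (.log (.mul (num 2) (real 12))))))
      (.storeReal 10 (.const 0) (.sub (.div (real 8) (.ofNat (.load 1 (.const 2))))
        (.mul (real 6) (.log (.sub (num 2) (.mul (num 2) (real 12))))))))

/-- Round the noisy value. -/
def round : Prog :=
  .seq (.storeReal 11 (.const 0) (.div (real 5) (num 16)))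
    (.loop (.conj (.realLt (real 11) (real 10)) (.realLt (real 11) (num 1)))
      (.storeReal 11 (.const 0) (.add (real 11) (.div (real 5) (num 16)))))

/-- Count the update. -/
def charge : Prog := .storeNat 4 (.const 0) (.add (nat 4) (.const 1))

/-- Run a program unless the budget is used up. -/
def guarded (p : Prog) : Prog := .cond (.realLt (.ofNat (nat 4)) budget) p .skip

/-- Compute the number of records at elements without weight. -/
def sumNew : Prog :=
  .seq (.storeReal 8 (.const 0) (num 0))
    (forNames (.cond (.realLt (num 0) (.load 3 name)) .skip
      (.storeReal 8 (.const 0) (.add (real 8) (.ofNat (.load 0 name))))))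

/-- Insert the elements without weight. -/
def insert : Prog :=
  forNames (.cond (.realLt (num 0) (.load 3 name)) .skip
    (.storeReal 3 name (.div (real 11) (.ofNat (nat 1)))))

/-- The first test and its update. -/
def first : Prog :=
  .seq sumNew (.seq noise (.seq round
    (.cond (.realLt (.div (real 5) (num 16)) (real 11)) (.seq charge insert) .skip)))

/-- Compute the total of the query over the records. -/
def sumTotal : Prog :=
  .seq (.storeReal 8 (.const 0) (num 0))
    (forNames (.storeReal 8 (.const 0) (.add (real 8) (.mul (.ofNat (.load 0 name)) weight))))

/-- Compute the value of the query on the hypothesis. -/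
def sumHyp : Prog :=
  .seq (.storeReal 9 (.const 0) (num 0))
    (forNames (.storeReal 9 (.const 0) (.add (real 9) (.mul (.load 3 name) weight))))

/-- The exponent of the multiplicative weights update. -/
def learn : Prog :=
  .cond (.realLt (real 9) (real 11)) (.storeReal 13 (.const 0) (.div (real 5) (num 8)))
    (.storeReal 13 (.const 0) (.sub (num 0) (.div (real 5) (num 8))))

/-- The multiplicative weights update. -/
def update : Prog :=
  forNames (.storeReal 3 name (.mul (.load 3 name) (.exp (.mul (real 13) weight))))

/-- The second test and its update. -/
def second : Prog :=
  .seq sumTotal (.seq sumHyp (.seq noise (.seq round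
    (.cond (.conj (.neg (.realLt (.div (real 5) (num 2)) (.sub (real 11) (real 9))))
        (.neg (.realLt (.div (real 5) (num 2)) (.sub (real 9) (real 11)))))
      (.storeReal 2 (.const 0) (real 9))
      (.seq (.storeReal 2 (.const 0) (real 11)) (.seq charge (.seq learn update)))))))

/-- Compute the parameters, and answer `0` for the time being. -/
def setup : Prog :=
  .seq (.storeReal 2 (.const 0) (num 0)) (.seq (.storeReal 5 (.const 0) accuracy)
    (.storeReal 6 (.const 0) scale))

/-- The response to a query. -/
def main : Prog :=
  .seq setup (.cond (.realLt (real 5) (num 1)) (.seq (guarded first) (guarded second)) .skip)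

end Program

/-! ## Correctness of the program -/

/-- The part of the memory that matters. -/
structure Snapshot where
  db : ℕ → ℕ
  natPar : ℕ → ℕ
  realPar : ℕ → ℝ
  query : RawQuery
  hyp : ℕ → ℝ
  updates : ℕ
  coin : ℕ
  ans : ℝ
  aux : ℝ

/-- The memory agrees with the snapshot. -/
structure View (c : Config) (S : Snapshot) (s : Mem) : Prop where
  db : s.nat 0 = S.db
  natPar : s.nat 1 = S.natPar
  name : s.nat 2 = S.query.name
  len : s.nat 3 0 = S.query.len
  updates : s.nat 4 0 = S.updates
  realPar : s.real 0 = S.realPar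
  weight : s.real 1 = S.query.weight
  ans : s.real 2 0 = S.ans
  hyp : s.real 3 = S.hyp
  accuracy : s.real 5 0 = c.α
  scale : s.real 6 0 = c.scale
  aux : s.real 9 0 = S.aux
  coin : s.coin = S.coin
  m : S.natPar 0 = c.m
  n : S.natPar 2 = c.n

@[simp] theorem setNat_nat (s : Mem) (a i v b : ℕ) :
    (s.setNat a i v).nat b = if b = a then Function.update (s.nat a) i v else s.nat b := by
  simp [Mem.setNat, Function.update_apply]

@[simp] theorem setNat_real (s : Mem) (a i v : ℕ) : (s.setNat a i v).real = s.real := rfl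

@[simp] theorem setNat_coin (s : Mem) (a i v : ℕ) : (s.setNat a i v).coin = s.coin := rfl

@[simp] theorem setReal_real (s : Mem) (a i : ℕ) (v : ℝ) (b : ℕ) :
    (s.setReal a i v).real b = if b = a then Function.update (s.real a) i v else s.real b := by
  simp [Mem.setReal, Function.update_apply]

@[simp] theorem setReal_nat (s : Mem) (a i : ℕ) (v : ℝ) : (s.setReal a i v).nat = s.nat := rfl

@[simp] theorem setReal_coin (s : Mem) (a i : ℕ) (v : ℝ) : (s.setReal a i v).coin = s.coin := rfl

section Correctness

variable {c : Config} {S : Snapshot} {s : Mem} {ω : ℕ → unitInterval}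

theorem View.setReal_scratch (h : View c S s) {a : ℕ} (ha : 7 ≤ a) (ha' : a ≠ 9) (i : ℕ) (v : ℝ) :
    View c S (s.setReal a i v) := by
  obtain ⟨h1, h2, h3, h4, h5, h6, h7, h8, h9, h10, h11, h12, h13, h14, h15⟩ := h
  have e : ∀ b, b < 7 ∨ b = 9 → (s.setReal a i v).real b = s.real b := fun b hb => by
    rw [setReal_real, if_neg (by omega)]
  exact ⟨h1, h2, h3, h4, h5, by rwa [e _ (by simp)], by rwa [e _ (by simp)],
    by rwa [e _ (by simp)], by rwa [e _ (by simp)], by rwa [e _ (by simp)], by rwa [e _ (by simp)],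
    by rwa [e _ (by simp)], h13, h14, h15⟩

theorem View.setNat_counter (h : View c S s) (i v : ℕ) : View c S (s.setNat 5 i v) := by
  obtain ⟨h1, h2, h3, h4, h5, h6, h7, h8, h9, h10, h11, h12, h13, h14, h15⟩ := h
  exact ⟨by simpa, by simpa, by simpa, by simpa, by simpa, h6, h7, h8, h9, h10, h11, h12, h13,
    h14, h15⟩

theorem View.setReal_hyp (h : View c S s) (i : ℕ) (v : ℝ) :
    View c { S with hyp := Function.update S.hyp i v } (s.setReal 3 i v) := by
  obtain ⟨h1, h2, h3, h4, h5, h6, h7, h8, h9, h10, h11, h12, h13, h14, h15⟩ := h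
  exact ⟨h1, h2, h3, h4, h5, by simpa, by simpa, by simpa, by simp [h9], by simpa, by simpa,
    by simpa, h13, h14, h15⟩

theorem View.setReal_ans (h : View c S s) (v : ℝ) :
    View c { S with ans := v } (s.setReal 2 0 v) := by
  obtain ⟨h1, h2, h3, h4, h5, h6, h7, h8, h9, h10, h11, h12, h13, h14, h15⟩ := h
  exact ⟨h1, h2, h3, h4, h5, by simpa, by simpa, by simp, by simpa, by simpa, by simpa,
    by simpa, h13, h14, h15⟩

theorem View.setReal_aux (h : View c S s) (v : ℝ) :
    View c { S with aux := v } (s.setReal 9 0 v) := by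
  obtain ⟨h1, h2, h3, h4, h5, h6, h7, h8, h9, h10, h11, h12, h13, h14, h15⟩ := h
  exact ⟨h1, h2, h3, h4, h5, by simpa, by simpa, by simpa, by simpa, by simpa, by simpa,
    by simp, h13, h14, h15⟩

theorem View.setNat_updates (h : View c S s) (v : ℕ) :
    View c { S with updates := v } (s.setNat 4 0 v) := by
  obtain ⟨h1, h2, h3, h4, h5, h6, h7, h8, h9, h10, h11, h12, h13, h14, h15⟩ := h
  exact ⟨by simpa, by simpa, by simpa, by simpa, by simp, h6, h7, h8, h9, h10, h11, h12, h13,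
    h14, h15⟩

theorem View.draw (h : View c S s) {a : ℕ} (ha : 7 ≤ a) (ha' : a ≠ 9) (i : ℕ) :
    View c { S with coin := S.coin + 1 } (s.draw ω a i) := by
  obtain ⟨h1, h2, h3, h4, h5, h6, h7, h8, h9, h10, h11, h12, h13, h14, h15⟩ :=
    h.setReal_scratch ha ha' i (ω s.coin : ℝ)
  exact ⟨h1, h2, h3, h4, h5, h6, h7, h8, h9, h10, h11, h12, by rw [← h13]; rfl, h14, h15⟩

/-- The invariant is indexed by the loop counter and must be insensitive to the counter's own cell.
Incrementing the counter and testing it cost 13 steps per iteration. -/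
theorem halts_forNames {I : ℕ → Mem → Prop} {L τ : ℕ} {p : Prog}
    (hcounter : ∀ j s v, I j s → I j (s.setNat 5 0 v)) (hlen : ∀ j s, I j s → s.nat 3 0 = L)
    (hstep : ∀ j < L, ∀ s, I j s → s.nat 5 0 = j →
      Halts ω p s (fun s' => I (j + 1) s' ∧ s'.nat 5 0 = j) τ) (h : I 0 s) :
    Halts ω (Program.forNames p) s (I L) (L * (τ + 13) + 10) := by
  have h1 : Halts ω (.storeNat 5 (.const 0) (.const 0)) s (fun s' => I 0 s' ∧ s'.nat 5 0 = 0) 3 :=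
    halts_storeNat ⟨hcounter _ _ _ h, by simp [NatExpr.eval]⟩
  refine (h1.seq (τ' := L * (τ + 13) + 6) fun s' hs' => ?_).mono (fun _ => id) (by omega)
  refine (halts_loop (I := fun j s => I j s ∧ s.nat 5 0 = j) (N := L) (τ := τ + 7) ?_ ?_ hs').mono
    (fun _ h => h.1) ?_
  · rintro j hj s ⟨hI, hc⟩
    refine ⟨by simpa [Test.Holds, NatExpr.eval, hc, hlen j s hI] using hj, ?_⟩
    refine ((hstep j hj s hI hc).seq fun s' hs' => halts_storeNat (Q := fun s =>
      I (j + 1) s ∧ s.nat 5 0 = j + 1) ⟨hcounter _ _ _ hs'.1, ?_⟩).mono (fun _ => id) ?_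
    · simp [NatExpr.eval, hs'.2]
    · simp [NatExpr.cost]
  · rintro s ⟨hI, hc⟩
    simp [Test.Holds, NatExpr.eval, hc, hlen L s hI]
  · simp [Test.cost, NatExpr.cost]

theorem halts_sumNew (h : View c S s) :
    Halts ω Program.sumNew s
      (fun s' => View c S s' ∧ s'.real 8 0 = S.query.newMass S.hyp S.db)
      (S.query.len * 40 + 20) := by
  refine ((halts_storeReal (Q := fun s => View c S s ∧ s.real 8 0 = 0)
    ⟨h.setReal_scratch (by norm_num) (by norm_num) _ _, by simp [RealExpr.eval, NatExpr.eval]⟩).seq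
    fun s' hs' => halts_forNames (L := S.query.len) (τ := 22) (I := fun j s => View c S s ∧
      s.real 8 0 = ∑ i ∈ Finset.range j, if 0 < S.hyp (S.query.name i) then 0
        else (S.db (S.query.name i) : ℝ)) (fun j s v hI => ⟨hI.1.setNat_counter _ _, hI.2⟩)
      (fun j s hI => hI.1.len) ?_ ⟨hs'.1, by simpa using hs'.2⟩).mono (fun s h => h) ?_
  · rintro j hj s ⟨hV, hs⟩ hc
    refine (halts_cond (τ := 1) (τ' := 10) (fun hb => halts_skip ⟨⟨hV, ?_⟩, hc⟩)
      (fun hb => halts_storeReal ⟨⟨hV.setReal_scratch (by norm_num) (by norm_num) _ _, ?_⟩, ?_⟩)).mono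
      (fun _ => id) ?_
    · simp [Test.cost, NatExpr.cost, RealExpr.cost]
    · simp only [Test.Holds, RealExpr.eval, NatExpr.eval, hc, hV.name, hV.hyp, Nat.cast_zero] at hb
      rw [Finset.sum_range_succ, if_pos hb, add_zero, hs]
    · simp only [Test.Holds, RealExpr.eval, NatExpr.eval, hc, hV.name, hV.hyp, Nat.cast_zero] at hb
      simp only [RealExpr.eval, NatExpr.eval, hc, hV.name]
      rw [Finset.sum_range_succ, if_neg hb, setReal_real, if_pos rfl, Function.update_self, hs,
        hV.db]
    · exact hc
  · simp [NatExpr.cost, RealExpr.cost]; omega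

theorem halts_sumTotal (h : View c S s) :
    Halts ω Program.sumTotal s
      (fun s' => View c S s' ∧ s'.real 8 0 = S.query.total S.db)
      (S.query.len * 40 + 20) := by
  refine ((halts_storeReal (Q := fun s => View c S s ∧ s.real 8 0 = 0)
    ⟨h.setReal_scratch (by norm_num) (by norm_num) _ _, by simp [RealExpr.eval, NatExpr.eval]⟩).seq
    fun s' hs' => halts_forNames (L := S.query.len) (τ := 22) (I := fun j s => View c S s ∧
      s.real 8 0 = ∑ i ∈ Finset.range j, S.db (S.query.name i) * S.query.weight i)
      (fun j s v hI => ⟨hI.1.setNat_counter _ _, hI.2⟩)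
      (fun j s hI => hI.1.len) ?_ ⟨hs'.1, by simpa using hs'.2⟩).mono (fun s h => h) ?_
  · rintro j hj s ⟨hV, hs⟩ hc
    refine (halts_storeReal ⟨⟨hV.setReal_scratch (by norm_num) (by norm_num) _ _, ?_⟩, ?_⟩).mono
      (fun _ => id) ?_
    · simp [NatExpr.cost, RealExpr.cost]
    · simp only [RealExpr.eval, NatExpr.eval, hc, hV.name]
      rw [Finset.sum_range_succ, setReal_real, if_pos rfl, Function.update_self, hs, hV.db,
        hV.weight]
    · exact hc
  · simp [NatExpr.cost, RealExpr.cost]; omega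

theorem halts_sumHyp {r : ℝ} (h : View c S s) (hr : s.real 8 0 = r) :
    Halts ω Program.sumHyp s
      (fun s' => View c { S with aux := S.query.onHyp S.hyp } s' ∧ s'.real 8 0 = r)
      (S.query.len * 40 + 20) := by
  refine ((halts_storeReal (Q := fun s => View c { S with aux := 0 } s ∧ s.real 8 0 = r)
    ⟨?_, by simpa using hr⟩).seq
    fun s' hs' => halts_forNames (L := S.query.len) (τ := 22) (I := fun j s =>
      View c { S with aux := ∑ i ∈ Finset.range j, S.hyp (S.query.name i) * S.query.weight i } s ∧
      s.real 8 0 = r) (fun j s v hI => ⟨hI.1.setNat_counter _ _, hI.2⟩)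
      (fun j s hI => hI.1.len) ?_ ⟨by simpa using hs'.1, hs'.2⟩).mono (fun s h => h) ?_
  · simpa [RealExpr.eval, NatExpr.eval] using h.setReal_aux 0
  · rintro j hj s ⟨hV, hs⟩ hc
    refine (halts_storeReal ⟨⟨?_, by simpa using hs⟩, hc⟩).mono (fun _ => id) ?_
    · simp [NatExpr.cost, RealExpr.cost]
    · have := hV.setReal_aux (∑ i ∈ Finset.range (j + 1),
        S.hyp (S.query.name i) * S.query.weight i)
      simp only [RealExpr.eval, NatExpr.eval, hc, hV.name, hV.hyp, hV.weight, hV.aux]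
      rwa [← Finset.sum_range_succ (fun i => S.hyp (S.query.name i) * S.query.weight i)]
  · simp [NatExpr.cost, RealExpr.cost]; omega

theorem halts_insert (h : View c S s) {v : ℝ} (hv : s.real 11 0 = v) :
    Halts ω Program.insert s
      (View c { S with hyp := insertNew S.query.name (v / c.m) S.hyp S.query.len })
      (S.query.len * 40 + 10) := by
  refine (halts_forNames (L := S.query.len) (τ := 22) (I := fun j s =>
    View c { S with hyp := insertNew S.query.name (v / c.m) S.hyp j } s ∧ s.real 11 0 = v)
    (fun j s v hI => ⟨hI.1.setNat_counter _ _, hI.2⟩) (fun j s hI => hI.1.len) ?_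
    ⟨h, hv⟩).mono (fun s h => h.1) (by omega)
  rintro j hj s ⟨hV, hs⟩ hc
  refine (halts_cond (τ := 1) (τ' := 10) (fun hb => halts_skip ⟨⟨?_, hs⟩, hc⟩)
    (fun hb => halts_storeReal ⟨⟨?_, by simpa using hs⟩, hc⟩)).mono
    (fun _ => id) ?_
  · simp [Test.cost, NatExpr.cost, RealExpr.cost]
  · simp only [Test.Holds, RealExpr.eval, NatExpr.eval, hc, hV.name, hV.hyp, Nat.cast_zero] at hb
    rw [insertNew, if_pos hb]
    exact hV
  · simp only [Test.Holds, RealExpr.eval, NatExpr.eval, hc, hV.name, hV.hyp, Nat.cast_zero] at hb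
    rw [insertNew, if_neg hb]
    have hm : s.nat 1 0 = c.m := by rw [hV.natPar]; exact hV.m
    simpa only [RealExpr.eval, NatExpr.eval, hc, hV.name, hs, hm] using
      hV.setReal_hyp (S.query.name j) (v / c.m)

theorem halts_update (h : View c S s) {η : ℝ} (hη : s.real 13 0 = η) :
    Halts ω Program.update s
      (View c { S with hyp := reweigh S.query.name S.query.weight η S.hyp S.query.len })
      (S.query.len * 40 + 10) := by
  refine (halts_forNames (L := S.query.len) (τ := 22) (I := fun j s =>
    View c { S with hyp := reweigh S.query.name S.query.weight η S.hyp j } s ∧ s.real 13 0 = η)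
    (fun j s v hI => ⟨hI.1.setNat_counter _ _, hI.2⟩) (fun j s hI => hI.1.len) ?_
    ⟨h, hη⟩).mono (fun s h => h.1) (by omega)
  rintro j hj s ⟨hV, hs⟩ hc
  refine (halts_storeReal ⟨⟨?_, by simpa using hs⟩, hc⟩).mono (fun _ => id) ?_
  · simp [NatExpr.cost, RealExpr.cost]
  · simpa only [RealExpr.eval, NatExpr.eval, hc, hV.name, hs, hV.hyp, hV.weight, reweigh] using
      hV.setReal_hyp (S.query.name j) (reweigh S.query.name S.query.weight η S.hyp j
        (S.query.name j) * Real.exp (η * S.query.weight j))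

theorem halts_noise {r : ℝ} (h : View c S s) (hr : s.real 8 0 = r) :
    Halts ω Program.noise s
      (fun s' => View c { S with coin := S.coin + 1 } s' ∧
        s'.real 10 0 = r / c.n + c.scale * lap (ω S.coin)) 50 := by
  refine ((halts_sample (Q := fun s => View c { S with coin := S.coin + 1 } s ∧ s.real 8 0 = r ∧
    s.real 12 0 = ω S.coin) ⟨h.draw (by norm_num) (by norm_num) _, ?_, ?_⟩).seq
    fun s' hs' => halts_cond (fun hb => halts_storeReal ⟨hs'.1.setReal_scratch (by norm_num)
      (by norm_num) _ _, ?_⟩) (fun hb => halts_storeReal ⟨hs'.1.setReal_scratch (by norm_num)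
      (by norm_num) _ _, ?_⟩)).mono (fun _ => id) ?_
  · simpa [Mem.draw] using hr
  · simp [Mem.draw, NatExpr.eval, h.coin]
  · simp [Test.cost, NatExpr.cost, RealExpr.cost]
  · have hn : s'.nat 1 2 = c.n := by rw [hs'.1.natPar]; exact hs'.1.n
    simp only [Test.Holds, RealExpr.eval, NatExpr.eval, hs'.2.2, Nat.cast_one, Nat.cast_ofNat] at hb
    simp only [RealExpr.eval, NatExpr.eval, hs'.2.1, hs'.2.2, hn, hs'.1.scale, lap, if_pos hb,
      setReal_real, if_true, Function.update_self, Nat.cast_ofNat]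
  · have hn : s'.nat 1 2 = c.n := by rw [hs'.1.natPar]; exact hs'.1.n
    simp only [Test.Holds, RealExpr.eval, NatExpr.eval, hs'.2.2, Nat.cast_one, Nat.cast_ofNat] at hb
    simp only [RealExpr.eval, NatExpr.eval, hs'.2.1, hs'.2.2, hn, hs'.1.scale, lap, if_neg hb,
      setReal_real, if_true, Function.update_self, Nat.cast_ofNat, mul_neg, sub_eq_add_neg]

/-- The loop starts at index 1 and stops at the first multiple of `α / 16` that reaches `min z 1`,
so it makes `quant z - 1` iterations. This replaces the missing rounding instruction, and the cap at
1 bounds the time for every sample. -/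
theorem halts_round {z : ℝ} (h : View c S s) (hz : s.real 10 0 = z) :
    Halts ω Program.round s (fun s' => View c S s' ∧ s'.real 11 0 = c.level (c.quant z))
      (c.quant z * 30 + 30) := by
  have hα := c.α_pos
  refine ((halts_storeReal (Q := fun s => (View c S s ∧ s.real 10 0 = z) ∧
    s.real 11 0 = c.level (0 + 1)) ⟨⟨h.setReal_scratch (by norm_num) (by norm_num) _ _,
      by simpa using hz⟩, ?_⟩).seq fun s' hs' => (halts_loop (τ := 10) (N := c.quant z - 1)
    (I := fun j s => (View c S s ∧ s.real 10 0 = z) ∧ s.real 11 0 = c.level (j + 1))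
    ?_ ?_ hs').mono (R := fun s' => View c S s' ∧ s'.real 11 0 = c.level (c.quant z))
      (fun s hs => ⟨hs.1.1, ?_⟩) le_rfl).mono (fun _ => id) ?_
  · simp [RealExpr.eval, NatExpr.eval, h.accuracy, Config.level]
  · rintro j hj s ⟨⟨hV, hz⟩, hl⟩
    refine ⟨?_, (halts_storeReal ⟨⟨hV.setReal_scratch (by norm_num) (by norm_num) _ _,
      by simpa using hz⟩, ?_⟩).mono (fun _ => id) ?_⟩
    · have h1 : j + 1 < ⌈min z 1 / (c.α / 16)⌉₊ := by
        have : j + 1 < c.quant z := by omega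
        rcases lt_max_iff.1 this with h | h
        · omega
        · exact h
      rw [Nat.lt_ceil, lt_div_iff₀ (by positivity), lt_min_iff] at h1
      simpa [Test.Holds, RealExpr.eval, NatExpr.eval, hl, hz, Config.level] using h1
    · simp [NatExpr.cost, RealExpr.cost]
    · simp [RealExpr.eval, NatExpr.eval, hl, hV.accuracy, Config.level]; ring
  · rintro s ⟨⟨hV, hz⟩, hl⟩
    rw [Nat.sub_add_cancel (c.quant_pos z)] at hl
    have h1 : min z 1 ≤ c.level (c.quant z) := by
      rw [Config.level, ← div_le_iff₀ (by positivity)]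
      exact (Nat.le_ceil _).trans (Nat.cast_le.2 (le_max_right _ _))
    simp only [Test.Holds, RealExpr.eval, NatExpr.eval, hl, hz, Nat.cast_one]
    rintro ⟨h2, h3⟩
    exact absurd (lt_min h2 h3) (not_lt.2 h1)
  · rw [hs.2, Nat.sub_add_cancel (c.quant_pos z)]
  · have := c.quant_pos z
    simp [Test.cost, NatExpr.cost, RealExpr.cost]; omega

end Correctness

/-! ### The two tests as phases of the program -/

section Phases

variable {c : Config} {S : Snapshot} {s : Mem} {ω : ℕ → unitInterval}

theorem Config.lt_level_iff (c : Config) {p : ℕ} (hp : 0 < p) : c.α / 16 < c.level p ↔ p ≠ 1 := by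
  have hα := c.α_pos
  rw [Config.level]
  constructor
  · rintro h rfl
    simp at h
  · intro h
    have h2 : (2 : ℝ) ≤ p := by exact_mod_cast (by omega : 2 ≤ p)
    nlinarith

theorem halts_charge (h : View c S s) {r : ℝ} {a : ℕ} (hr : s.real a 0 = r) :
    Halts ω Program.charge s
      (fun s' => View c { S with updates := S.updates + 1 } s' ∧ s'.real a 0 = r) 10 := by
  refine (halts_storeNat ⟨?_, by simpa using hr⟩).mono (fun _ => id) ?_
  · simp [NatExpr.cost]
  · simpa only [NatExpr.eval, h.updates] using h.setNat_updates (S.updates + 1)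

/-- The effect of the first test when the noisy value is rounded to the multiple with index
`p`. -/
def Snapshot.afterFirst (c : Config) (S : Snapshot) (p : ℕ) : Snapshot :=
  if p = 1 then { S with coin := S.coin + 1 }
  else { S with
    coin := S.coin + 1
    updates := S.updates + 1
    hyp := insertNew S.query.name (c.level p / c.m) S.hyp S.query.len }

open Classical in
/-- The effect of the second test when the noisy value is rounded to the multiple with index
`p`. -/
def Snapshot.afterSecond (c : Config) (S : Snapshot) (p : ℕ) : Snapshot :=
  if |c.level p - S.query.onHyp S.hyp| ≤ c.α / 2 then
    { S with
      coin := S.coin + 1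
      aux := S.query.onHyp S.hyp
      ans := S.query.onHyp S.hyp }
  else
    { S with
      coin := S.coin + 1
      aux := S.query.onHyp S.hyp
      ans := c.level p
      updates := S.updates + 1
      hyp := reweigh S.query.name S.query.weight
        (if S.query.onHyp S.hyp < c.level p then c.α / 8 else -(c.α / 8)) S.hyp S.query.len }

theorem halts_first (h : View c S s) :
    Halts ω Program.first s
      (View c (S.afterFirst c
        (c.quant (S.query.newMass S.hyp S.db / c.n + c.scale * lap (ω S.coin)))))
      (S.query.len * 80 +
        c.quant (S.query.newMass S.hyp S.db / c.n + c.scale * lap (ω S.coin)) * 30 + 200) := by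
  refine ((halts_sumNew h).seq fun s h => (halts_noise h.1 h.2).seq fun s h =>
    (halts_round h.1 h.2).seq fun s h => halts_cond
      (τ := S.query.len * 40 + 30) (τ' := 1) (fun hb => ?_) (fun hb => ?_)).mono (fun _ => id) ?_
  · simp only [Test.Holds, RealExpr.eval, NatExpr.eval, h.1.accuracy, h.2, Nat.cast_ofNat,
      c.lt_level_iff (c.quant_pos _)] at hb
    rw [Snapshot.afterFirst, if_neg hb]
    exact ((halts_charge h.1 h.2).seq fun s h => halts_insert h.1 h.2).mono (fun _ => id) (by simp; omega)
  · simp only [Test.Holds, RealExpr.eval, NatExpr.eval, h.1.accuracy, h.2, Nat.cast_ofNat,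
      c.lt_level_iff (c.quant_pos _), not_not] at hb
    rw [Snapshot.afterFirst, if_pos hb]
    exact halts_skip h.1
  · simp only [Test.cost, RealExpr.cost, NatExpr.cost]; omega

theorem halts_learn (h : View c S s) {v : ℝ} (hv : s.real 11 0 = v) :
    Halts ω Program.learn s
      (fun s => View c S s ∧ s.real 13 0 = if S.aux < v then c.α / 8 else -(c.α / 8)) 30 := by
  refine (halts_cond
    (fun hb => halts_storeReal ⟨h.setReal_scratch (by norm_num) (by norm_num) _ _, ?_⟩)
    (fun hb => halts_storeReal ⟨h.setReal_scratch (by norm_num) (by norm_num) _ _, ?_⟩)).mono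
    (fun _ => id) ?_
  · simp [Test.cost, RealExpr.cost, NatExpr.cost]
  · simp only [Test.Holds, RealExpr.eval, NatExpr.eval, h.aux, hv] at hb
    simp only [RealExpr.eval, NatExpr.eval, h.accuracy, if_pos hb,
      setReal_real, if_true, Function.update_self, Nat.cast_ofNat]
  · simp only [Test.Holds, RealExpr.eval, NatExpr.eval, h.aux, hv] at hb
    simp only [RealExpr.eval, NatExpr.eval, h.accuracy, if_neg hb,
      setReal_real, if_true, Function.update_self, Nat.cast_ofNat, Nat.cast_zero, zero_sub]

theorem halts_answer (h : View c S s) {v : ℝ} (hv : s.real 11 0 = v) :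
    Halts ω (.storeReal 2 (.const 0) (Program.real 11)) s
      (fun s' => View c { S with ans := v } s' ∧ s'.real 11 0 = v) 4 := by
  refine halts_storeReal ⟨?_, by simpa using hv⟩
  simpa only [RealExpr.eval, NatExpr.eval, hv] using h.setReal_ans v

theorem halts_second (h : View c S s) :
    Halts ω Program.second s
      (View c (S.afterSecond c (c.quant (S.query.total S.db / c.n + c.scale * lap (ω S.coin)))))
      (S.query.len * 120 +
        c.quant (S.query.total S.db / c.n + c.scale * lap (ω S.coin)) * 30 + 300) := by
  refine ((halts_sumTotal h).seq fun s h => (halts_sumHyp h.1 h.2).seq fun s h =>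
    (halts_noise h.1 h.2).seq fun s h =>
    (halts_round h.1 h.2).seq fun s h => halts_cond
      (τ := 5) (τ' := S.query.len * 40 + 70) (fun hb => ?_) (fun hb => ?_)).mono (fun _ => id) ?_
  · have hb' : |c.level (c.quant (S.query.total S.db / c.n + c.scale * lap (ω S.coin))) -
        S.query.onHyp S.hyp| ≤ c.α / 2 := by
      simp only [Test.Holds, RealExpr.eval, NatExpr.eval, h.1.accuracy, h.1.aux, h.2,
        Nat.cast_ofNat] at hb
      rw [not_lt, not_lt] at hb
      rw [abs_le]; constructor <;> linarith [hb.1, hb.2]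
    rw [Snapshot.afterSecond, if_pos hb']
    refine (halts_storeReal ?_).mono (fun _ => id) ?_
    · simpa only [RealExpr.eval, NatExpr.eval, h.1.aux] using
        h.1.setReal_ans (S.query.onHyp S.hyp)
    · simp [RealExpr.cost, NatExpr.cost]
  · have hb' : ¬ |c.level (c.quant (S.query.total S.db / c.n + c.scale * lap (ω S.coin))) -
        S.query.onHyp S.hyp| ≤ c.α / 2 := by
      intro hcon
      rw [abs_le] at hcon
      apply hb
      simp only [Test.Holds, RealExpr.eval, NatExpr.eval, h.1.accuracy, h.1.aux, h.2,
        Nat.cast_ofNat, not_lt]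
      constructor <;> linarith [hcon.1, hcon.2]
    rw [Snapshot.afterSecond, if_neg hb']
    exact ((halts_answer h.1 h.2).seq fun s h => (halts_charge h.1 h.2).seq fun s h =>
      (halts_learn h.1 h.2).seq fun s h => halts_update h.1 h.2).mono (fun _ => id)
      (by simp only; omega)
  · simp only [Test.cost, RealExpr.cost, NatExpr.cost]; omega

end Phases

/-! ## The response to a query -/

/-- The part of the memory that is carried over to the next round. -/
structure Carries (d p : ℕ → ℕ) (r : ℕ → ℝ) (σ : State) (s : Mem) : Prop where
  db : s.nat 0 = d
  natPar : s.nat 1 = p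
  realPar : s.real 0 = r
  hyp : s.real 3 = σ.hyp
  updates : s.nat 4 0 = σ.updates

/-- One test. -/
def Tests.step {St : Type*} (T : Tests St) (val : ℕ → St → ℝ) (u : unitInterval) (t : ℕ) (σ : St) :
    St :=
  T.next t σ (T.out t σ (val t σ + T.scale * lap u))

section Response

variable (c : Config) (query : ℕ → (ℕ → ℝ) → RawQuery) (d : ℕ → ℕ) {σ : State} {i : ℕ}

theorem Config.step_first (hact : c.Active σ) (u : unitInterval) (S : Snapshot)
    (hq : S.query = query i σ.answers) (hd : S.db = d)
    (hh : S.hyp = σ.hyp) (hu : S.updates = σ.updates) :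
    (S.afterFirst c (c.quant (S.query.newMass S.hyp S.db / c.n + c.scale * lap u))).hyp =
      ((c.tests query).step (c.val query d) u (2 * i) σ).hyp ∧
    (S.afterFirst c (c.quant (S.query.newMass S.hyp S.db / c.n + c.scale * lap u))).updates =
      ((c.tests query).step (c.val query d) u (2 * i) σ).updates ∧
    ((c.tests query).step (c.val query d) u (2 * i) σ).answers = σ.answers := by
  have e1 : 2 * i % 2 = 0 := by omega
  have e2 : 2 * i / 2 = i := by omega
  subst hd
  simp only [Tests.step, Config.tests, Config.val, e1, e2, if_true, if_pos hact, ← hq, ← hh]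
  set p := c.quant (S.query.newMass S.hyp S.db / c.n + c.scale * lap u) with hp
  have hp0 : p ≠ 0 := (c.quant_pos _).ne'
  by_cases h1 : p = 1
  · simp [Snapshot.afterFirst, h1, hh, hu]
  · simp [Snapshot.afterFirst, h1, hp0, hu]

theorem Config.step_second (hact : c.Active σ) (u : unitInterval) (S : Snapshot)
    (hq : S.query = query i σ.answers) (hd : S.db = d)
    (hh : S.hyp = σ.hyp) (hu : S.updates = σ.updates) :
    (S.afterSecond c (c.quant (S.query.total S.db / c.n + c.scale * lap u))).hyp =
      ((c.tests query).step (c.val query d) u (2 * i + 1) σ).hyp ∧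
    (S.afterSecond c (c.quant (S.query.total S.db / c.n + c.scale * lap u))).updates =
      ((c.tests query).step (c.val query d) u (2 * i + 1) σ).updates ∧
    ((c.tests query).step (c.val query d) u (2 * i + 1) σ).answers = Function.update σ.answers i
      (S.afterSecond c (c.quant (S.query.total S.db / c.n + c.scale * lap u))).ans := by
  have e1 : ¬ (2 * i + 1) % 2 = 0 := by omega
  have e2 : (2 * i + 1) / 2 = i := by omega
  subst hd
  simp only [Tests.step, Config.tests, Config.val, e1, e2, if_false, if_pos hact, ← hq, ← hh]
  set p := c.quant (S.query.total S.db / c.n + c.scale * lap u) with hp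
  have hp0 : p ≠ 0 := (c.quant_pos _).ne'
  by_cases h1 : |c.level p - S.query.onHyp S.hyp| ≤ c.α / 2
  · simp only [Snapshot.afterSecond, if_pos h1, if_true, hu, and_self]
  · simp only [Snapshot.afterSecond, if_neg h1, hp0, if_false, hu, and_self]

theorem Config.step_first_of_not_active (hact : ¬ c.Active σ) (u : unitInterval) :
    (c.tests query).step (c.val query d) u (2 * i) σ = σ := by
  have e1 : 2 * i % 2 = 0 := by omega
  simp [Tests.step, Config.tests, hact]

theorem Config.step_second_of_not_active (hact : ¬ c.Active σ) (u : unitInterval) :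
    (c.tests query).step (c.val query d) u (2 * i + 1) σ =
      ⟨σ.hyp, σ.updates, Function.update σ.answers i 0⟩ := by
  have e1 : ¬ (2 * i + 1) % 2 = 0 := by omega
  have e2 : (2 * i + 1) / 2 = i := by omega
  simp only [Tests.step, Config.tests, e1, e2, if_false, if_neg hact]

theorem Snapshot.afterFirst_frame (S : Snapshot) (p : ℕ) :
    (S.afterFirst c p).db = S.db ∧ (S.afterFirst c p).natPar = S.natPar ∧
    (S.afterFirst c p).realPar = S.realPar ∧ (S.afterFirst c p).query = S.query ∧
    (S.afterFirst c p).coin = S.coin + 1 ∧ (S.afterFirst c p).ans = S.ans := by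
  unfold afterFirst; split_ifs <;> simp

theorem Snapshot.afterSecond_frame (S : Snapshot) (p : ℕ) :
    (S.afterSecond c p).db = S.db ∧ (S.afterSecond c p).natPar = S.natPar ∧
    (S.afterSecond c p).realPar = S.realPar := by
  unfold afterSecond; split_ifs <;> simp

theorem View.carries {S : Snapshot} {s : Mem} {τ : State} (h : View c S s) (hh : S.hyp = τ.hyp)
    (hu : S.updates = τ.updates) : Carries S.db S.natPar S.realPar τ s :=
  ⟨h.db, h.natPar, h.realPar, h.hyp.trans hh, h.updates.trans hu⟩

theorem View.budget_eval {S : Snapshot} {s : Mem} (h : View c S s) :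
    Program.budget.eval s = c.budget := by
  have hm : s.nat 1 0 = c.m := by rw [h.natPar]; exact h.m
  simp [Program.budget, RealExpr.eval, NatExpr.eval, h.accuracy, hm, Config.budget]

/-- The snapshot belongs to round `i` in state `σ`. -/
structure Snapshot.Matches (S : Snapshot) (p : ℕ → ℕ) (r : ℕ → ℝ) (i : ℕ) (σ : State) : Prop where
  db : S.db = d
  natPar : S.natPar = p
  realPar : S.realPar = r
  query : S.query = query i σ.answers
  hyp : S.hyp = σ.hyp
  updates : S.updates = σ.updates
  ans : S.ans = 0

/-- The position of the coin is claimed only if the mechanism is still active afterwards: an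
inactive round reads no sample, and then the second test reads none either. So the second test,
whenever it samples, uses the coin 1 of the round. -/
theorem halts_guarded_first {p : ℕ → ℕ} {r : ℕ → ℝ} {s : Mem} {ω : ℕ → unitInterval} {S : Snapshot}
    (h : View c S s) (hS : S.Matches query d p r i σ) (hcoin : S.coin = 0) (hα : c.α < 1) :
    Halts ω (Program.guarded Program.first) s (fun s' => ∃ S' : Snapshot, View c S' s' ∧
      S'.Matches query d p r i ((c.tests query).step (c.val query d) (ω 0) (2 * i) σ) ∧
      (c.Active ((c.tests query).step (c.val query d) (ω 0) (2 * i) σ) → S'.coin = 1))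
      ((query i σ.answers).len * 80 + (max 1 ⌈1 / (c.α / 16)⌉₊) * 30 + 300) := by
  have hact : (Test.realLt (.ofNat (Program.nat 4)) Program.budget).Holds s ↔ c.Active σ := by
    simp only [Test.Holds, h.budget_eval, RealExpr.eval, NatExpr.eval, h.updates, hS.updates,
      Config.Active, hα, true_and]
  refine (halts_cond (τ := (query i σ.answers).len * 80 + (max 1 ⌈1 / (c.α / 16)⌉₊) * 30 + 200)
    (τ' := 1) (fun hb => ?_) (fun hb => halts_skip ⟨S, h, ?_⟩)).mono (fun _ => id) ?_
  · rw [hact] at hb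
    obtain ⟨e1, e2, e3⟩ := c.step_first query d hb (ω 0) S hS.query hS.db hS.hyp hS.updates
    have hp := c.quant_le (S.query.newMass S.hyp S.db / c.n + c.scale * lap (ω S.coin))
    refine (halts_first h).mono (fun s' h' => ⟨_, h', ?_, fun _ => ?_⟩) ?_
    · obtain ⟨f1, f2, f3, f4, f5, f6⟩ := S.afterFirst_frame c
        (c.quant (S.query.newMass S.hyp S.db / c.n + c.scale * lap (ω S.coin)))
      rw [hcoin] at *
      exact ⟨f1.trans hS.db, f2.trans hS.natPar, f3.trans hS.realPar,
        by rw [f4, hS.query, e3], e1, e2, f6.trans hS.ans⟩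
    · rw [(S.afterFirst_frame c _).2.2.2.2.1, hcoin]
    · rw [hS.query] at *
      omega
  · simp only [Test.cost, RealExpr.cost, NatExpr.cost, Program.budget]
    omega
  · rw [hact] at hb
    rw [c.step_first_of_not_active query d hb]
    exact ⟨hS, fun h => absurd h hb⟩

theorem halts_guarded_second {p : ℕ → ℕ} {r : ℕ → ℝ} {s : Mem} {ω : ℕ → unitInterval}
    {S : Snapshot} (h : View c S s) (hS : S.Matches query d p r i σ)
    (hcoin : c.Active σ → S.coin = 1) (hα : c.α < 1) :
    Halts ω (Program.guarded Program.second) s (fun s' =>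
      Carries d p r ((c.tests query).step (c.val query d) (ω 1) (2 * i + 1) σ) s' ∧
      ((c.tests query).step (c.val query d) (ω 1) (2 * i + 1) σ).answers =
        Function.update σ.answers i s'.answer)
      ((query i σ.answers).len * 120 + (max 1 ⌈1 / (c.α / 16)⌉₊) * 30 + 400) := by
  have hact : (Test.realLt (.ofNat (Program.nat 4)) Program.budget).Holds s ↔ c.Active σ := by
    simp only [Test.Holds, h.budget_eval, RealExpr.eval, NatExpr.eval, h.updates, hS.updates,
      Config.Active, hα, true_and]
  refine (halts_cond (τ := (query i σ.answers).len * 120 + (max 1 ⌈1 / (c.α / 16)⌉₊) * 30 + 300)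
    (τ' := 1) (fun hb => ?_) (fun hb => halts_skip ?_)).mono (fun _ => id) ?_
  · rw [hact] at hb
    obtain ⟨e1, e2, e3⟩ := c.step_second query d hb (ω 1) S hS.query hS.db hS.hyp hS.updates
    have hp := c.quant_le (S.query.total S.db / c.n + c.scale * lap (ω S.coin))
    refine (halts_second h).mono (fun s' h' => ?_) ?_
    · obtain ⟨f1, f2, f3⟩ := S.afterSecond_frame c
        (c.quant (S.query.total S.db / c.n + c.scale * lap (ω S.coin)))
      have ha := h'.ans
      rw [hcoin hb] at *
      refine ⟨?_, ?_⟩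
      · have := h'.carries c e1 e2
        rwa [f1, f2, f3, hS.db, hS.natPar, hS.realPar] at this
      · rw [e3, Mem.answer, ha]
    · rw [hS.query] at *
      omega
  · rw [hact] at hb
    rw [c.step_second_of_not_active query d hb]
    refine ⟨⟨h.db.trans hS.db, h.natPar.trans hS.natPar, h.realPar.trans hS.realPar,
      h.hyp.trans hS.hyp, h.updates.trans hS.updates⟩, ?_⟩
    rw [Mem.answer, h.ans, hS.ans]
  · simp only [Test.cost, RealExpr.cost, NatExpr.cost, Program.budget]
    omega

/-- The parameters are recomputed in every round, and `setup` writes the answer 0 first, which is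
therefore the answer whenever the second test is skipped. -/
theorem halts_main {p : ℕ → ℕ} {r : ℕ → ℝ} {s : Mem} {ω : ℕ → unitInterval}
    (hs : Carries d p r σ s) (hm : p 0 = c.m) (hn : p 2 = c.n) (hcoin : s.coin = 0)
    (hname : s.nat 2 = (query i σ.answers).name) (hlen : s.nat 3 0 = (query i σ.answers).len)
    (hweight : s.real 1 = (query i σ.answers).weight)
    (hα : ∀ s' : Mem, s'.nat 1 = p → s'.real 0 = r → Program.accuracy.eval s' = c.α)
    (hscale : ∀ s' : Mem, s'.nat 1 = p → s'.real 0 = r → s'.real 5 0 = c.α →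
      Program.scale.eval s' = c.scale) :
    Halts ω Program.main s (fun s' =>
      Carries d p r ((c.tests query).step (c.val query d) (ω 1) (2 * i + 1)
        ((c.tests query).step (c.val query d) (ω 0) (2 * i) σ)) s' ∧
      ((c.tests query).step (c.val query d) (ω 1) (2 * i + 1)
        ((c.tests query).step (c.val query d) (ω 0) (2 * i) σ)).answers =
        Function.update σ.answers i s'.answer)
      (100 + if c.α < 1 then (query i σ.answers).len * 200 +
        (max 1 ⌈1 / (c.α / 16)⌉₊) * 60 + 700 else 0) := by
  set q := query i σ.answers with hq
  set S : Snapshot := ⟨d, p, r, q, σ.hyp, σ.updates, 0, 0, s.real 9 0⟩ with hS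
  have hsetup : Halts ω Program.setup s (View c S) 75 := by
    refine Halts.mono (Halts.seq (halts_storeReal
      (Q := fun s' => s' = s.setReal 2 0 0) (by simp [RealExpr.eval, NatExpr.eval]))
      fun s1 h1 => Halts.seq (halts_storeReal (Q := fun s' => s' = s1.setReal 5 0 c.α)
        ?_) fun s2 h2 => halts_storeReal ?_) (fun _ => id) ?_
    · rw [hα _ (by rw [h1]; simpa using hs.natPar) (by rw [h1]; simpa using hs.realPar)]
      rfl
    · subst h1 h2
      rw [hscale _ (by simpa using hs.natPar) (by simpa using hs.realPar) (by simp)]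
      obtain ⟨h1, h2, h3, h4, h5⟩ := hs
      constructor <;> simp [NatExpr.eval, *]
    · simp [Program.accuracy, Program.scale, RealExpr.cost, NatExpr.cost]
  have hS' : S.Matches query d p r i σ := ⟨rfl, rfl, rfl, rfl, rfl, rfl, rfl⟩
  by_cases hlt : c.α < 1
  · rw [if_pos hlt]
    refine (hsetup.seq fun s h => halts_cond (τ := q.len * 200 +
      (max 1 ⌈1 / (c.α / 16)⌉₊) * 60 + 701) (τ' := 1) (fun _ => ?_) (fun hb => ?_)).mono
      (fun _ => id) ?_
    · have hans : ((c.tests query).step (c.val query d) (ω 0) (2 * i) σ).answers = σ.answers := by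
        by_cases hact : c.Active σ
        · rw [(c.step_first query d hact (ω 0) S rfl rfl rfl rfl).2.2]
        · rw [c.step_first_of_not_active query d hact]
      have h2 := (halts_guarded_first c query d (ω := ω) h hS' rfl hlt).seq
        fun s ⟨S', hV, hM, hc⟩ => halts_guarded_second c query d hV hM hc hlt
      simp only [hans] at h2
      exact h2.mono (fun _ => id) (by rw [hq]; omega)
    · exact absurd (by simpa [Test.Holds, RealExpr.eval, NatExpr.eval, h.accuracy] using hlt) hb
    · simp only [Test.cost, RealExpr.cost, NatExpr.cost]
      omega
  · rw [if_neg hlt]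
    refine (hsetup.seq fun s h => halts_cond (τ := 1) (τ' := 1) (fun hb => ?_)
      (fun hb => halts_skip ?_)).mono (fun _ => id) ?_
    · exact absurd (by simpa [Test.Holds, RealExpr.eval, NatExpr.eval, h.accuracy] using hb) hlt
    · have hact : ¬ c.Active σ := fun h => hlt h.1
      rw [c.step_first_of_not_active query d hact, c.step_second_of_not_active query d hact]
      refine ⟨⟨h.db, h.natPar, h.realPar, h.hyp, h.updates⟩, ?_⟩
      rw [Mem.answer, h.ans]
    · simp only [Test.cost, RealExpr.cost, NatExpr.cost]
      omega

end Response

/-! ## Runs of the program -/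

theorem Tests.run_succ_eq_step {St : Type*} (T : Tests St) (val : ℕ → St → ℝ) (ω : Coins) (n : ℕ)
    (σ : St) : T.run val ω (n + 1) 0 σ = T.step val (coin n ω) n (T.run val ω n 0 σ) := by
  rw [Tests.run_succ, zero_add]
  rfl

section Runs

variable (c : Config) (query : ℕ → (ℕ → ℝ) → RawQuery) (d : ℕ → ℕ) (ω : Coins)

/-- The state before round `i`. -/
def Config.stateAt (i : ℕ) : State := (c.tests query).run (c.val query d) ω (2 * i) 0 Config.start

theorem Config.stateAt_succ (i : ℕ) :
    c.stateAt query d ω (i + 1) =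
      (c.tests query).step (c.val query d) (ω (i, 1)) (2 * i + 1)
        ((c.tests query).step (c.val query d) (ω (i, 0)) (2 * i) (c.stateAt query d ω i)) := by
  have e1 : coin (2 * i + 1) ω = ω (i, 1) := by
    rw [coin, show (2 * i + 1) / 2 = i by omega, show (2 * i + 1) % 2 = 1 by omega]
  have e2 : coin (2 * i) ω = ω (i, 0) := by
    rw [coin, show 2 * i / 2 = i by omega, show 2 * i % 2 = 0 by omega]
  rw [Config.stateAt, show 2 * (i + 1) = 2 * i + 1 + 1 by ring, Tests.run_succ_eq_step,
    Tests.run_succ_eq_step, e1, e2]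
  rfl

theorem Config.step_answers_of_ne (u : unitInterval) (t : ℕ) (σ : State) {j : ℕ} (hj : j ≠ t / 2) :
    ((c.tests query).step (c.val query d) u t σ).answers j = σ.answers j := by
  simp only [Tests.step, Config.tests]
  split_ifs <;> simp [hj]

/-- An answer is never overwritten after its own round. This allows the whole transcript to be read
off the final state, although queries depend only on earlier answers. -/
theorem Config.stateAt_answers {i j : ℕ} (hij : i < j) :
    (c.stateAt query d ω j).answers i = (c.stateAt query d ω (i + 1)).answers i := by
  induction j, hij using Nat.le_induction with
  | base => rfl
  | succ j hj ih =>
    rw [Config.stateAt_succ, Config.step_answers_of_ne _ _ _ _ _ _ (by omega),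
      Config.step_answers_of_ne _ _ _ _ _ _ (by omega), ih]

theorem Config.stateAt_answers_congr {i j : ℕ} (hij : i ≤ j) {l : ℕ} (hl : l < i) :
    (c.stateAt query d ω j).answers l = (c.stateAt query d ω i).answers l := by
  rw [Config.stateAt_answers _ _ _ _ (hl.trans_le hij), Config.stateAt_answers _ _ _ _ hl]

end Runs

theorem exists_seq_of_step {α : Type*} {P : ℕ → α → Prop} {R : ℕ → α → α → Prop} {a : α}
    (h0 : P 0 a) (hstep : ∀ i x, P i x → ∃ y, P (i + 1) y ∧ R i x y) :
    ∃ s : ℕ → α, s 0 = a ∧ ∀ i, P i (s i) ∧ R i (s i) (s (i + 1)) := by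
  choose! f hf using hstep
  let s : ℕ → α := fun n => Nat.rec a (fun i x => f i x) n
  have hP : ∀ i, P i (s i) := fun i => by
    induction i with
    | zero => exact h0
    | succ i ih => exact (hf i _ ih).1
  exact ⟨s, rfl, fun i => ⟨hP i, (hf i _ (hP i)).2⟩⟩

theorem runs_main {X : Type*} [Encodable X] {m k n : ℕ} {ε δ β τ : ℝ} (c : Config)
    (hm : c.m = m) (hn : c.n = n)
    (hα : ∀ s : Mem, s.nat 1 = (fun i => [m, k, n].getD i 0) →
      s.real 0 = (fun i => [ε, δ, β].getD i 0) → Program.accuracy.eval s = c.α)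
    (hscale : ∀ s : Mem, s.nat 1 = (fun i => [m, k, n].getD i 0) →
      s.real 0 = (fun i => [ε, δ, β].getD i 0) → s.real 5 0 = c.α →
      Program.scale.eval s = c.scale)
    (hτ : ∀ len ≤ m, ((100 + if c.α < 1 then len * 200 +
        (max 1 ⌈1 / (c.α / 16)⌉₊) * 60 + 700 else 0 : ℕ) : ℝ) ≤ τ)
    (D : Multiset X) (A : Adversary X m k) (ω : Coins) :
    Runs Program.main ε δ β n D A ω τ (c.mechanism D A ω) := by
  set σ := c.stateAt A.strategy (counts D) ω with hσ
  have hmech : c.mechanism D A ω = A.transcript (σ k).answers := rfl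
  have hnext : ∀ i : Fin k, (c.mechanism D A ω i).1 = A.next i fun j => (σ i).answers j := by
    intro i
    rw [hmech]
    simp only [Adversary.transcript]
    congr 1
    funext j
    exact c.stateAt_answers_congr _ _ _ i.2.le j.2
  obtain ⟨s, hs0, hs⟩ := exists_seq_of_step (a := initMem ε δ β m k n D)
    (P := fun i s => i ≤ k → Carries (counts D) (fun i => [m, k, n].getD i 0)
      (fun i => [ε, δ, β].getD i 0) (σ i) s)
    (R := fun i s s' => ∀ h : i < k, (∃ t : ℕ, (t : ℝ) ≤ τ ∧ Exec (fun j => ω (i, j)) Program.main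
      (s.receive (c.mechanism D A ω ⟨i, h⟩).1) s' t) ∧
      (c.mechanism D A ω ⟨i, h⟩).2 = s'.answer)
    (fun _ => by constructor <;> rfl)
    (fun i s hs => by
      by_cases h : i < k
      · have hc := hs h.le
        have hq : A.strategy i (σ i).answers = (c.mechanism D A ω ⟨i, h⟩).1.raw := by
          rw [hnext ⟨i, h⟩, Adversary.strategy, dif_pos h]
        have hmain := halts_main (s := s.receive (c.mechanism D A ω ⟨i, h⟩).1) (σ := σ i)
          c A.strategy (counts D) (i := i) (ω := fun j => ω (i, j))
          ⟨hc.db, hc.natPar, hc.realPar, hc.hyp, hc.updates⟩ hm.symm hn.symm rfl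
          (by rw [hq]; rfl) (by rw [hq]; rfl) (by rw [hq]; rfl) hα hscale
        obtain ⟨s', t, he, ⟨hcar, hans⟩, ht⟩ := hmain
        rw [← c.stateAt_succ] at hcar hans
        refine ⟨s', fun _ => hcar, fun _ => ⟨⟨t, ?_, he⟩, ?_⟩⟩
        · exact (Nat.cast_le.2 ht).trans (hτ _ (A.strategy_valid i _).len_le)
        · rw [hmech]
          simp only [Adversary.transcript]
          rw [hσ, c.stateAt_answers _ _ _ h, hans, Function.update_self]
      -- After the last round the memory sequence is continued by a constant; nothing is claimed
      -- there.
      · exact ⟨s, fun h' => absurd h' h, fun h' => absurd h' h⟩)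
  exact ⟨s, hs0, fun i => ⟨rfl, ((hs i).2 i.2).1, ((hs i).2 i.2).2⟩⟩

/-! ### The computed parameters and the time bound -/

/-- The machine has no roots, so the program forms the powers as exponentials of multiples of
logarithms. This is legitimate because `log m`, `log (4 / δ)` and `log (k / β)` are positive for the
admitted parameters. -/
theorem accuracy_eval {m k n : ℕ} {ε δ β : ℝ} (hε : 0 < ε) (hδ : 0 < δ) (hδ1 : δ < 1)
    (hβ : 0 < β) (hβ1 : β < 1) (hm : 2 ≤ m) (hk : 1 ≤ k) (hn : 1 ≤ n) {s : Mem}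
    (h1 : s.nat 1 = fun i => [m, k, n].getD i 0) (h0 : s.real 0 = fun i => [ε, δ, β].getD i 0) :
    Program.accuracy.eval s = 1000 * (Real.log m ^ (1 / 4 : ℝ) *
      (Real.log (4 / δ) * Real.log (k / β)) ^ (1 / 2 : ℝ) / (ε * n) ^ (1 / 2 : ℝ)) := by
  have hlm : 0 < Real.log m := Real.log_pos (by exact_mod_cast hm)
  have hlδ : 0 < Real.log (4 / δ) := Real.log_pos (by rw [lt_div_iff₀ hδ]; linarith)
  have hk' : (1 : ℝ) ≤ k := by exact_mod_cast hk
  have hlk : 0 < Real.log (k / β) := Real.log_pos (by rw [lt_div_iff₀ hβ]; linarith)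
  have hn' : (0 : ℝ) < n := by exact_mod_cast hn
  rw [Real.rpow_def_of_pos hlm, Real.rpow_def_of_pos (by positivity),
    Real.rpow_def_of_pos (by positivity), ← Real.exp_add, ← Real.exp_sub,
    Real.log_mul hlδ.ne' hlk.ne']
  simp only [Program.accuracy, RealExpr.eval, NatExpr.eval, h1, h0]
  simp only [List.getD_cons_zero, List.getD_cons_succ, Nat.cast_ofNat]
  congr 2
  ring

theorem scale_eval {m k n : ℕ} {ε δ β α : ℝ} {s : Mem}
    (h1 : s.nat 1 = fun i => [m, k, n].getD i 0) (h0 : s.real 0 = fun i => [ε, δ, β].getD i 0)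
    (h5 : s.real 5 0 = α) :
    Program.scale.eval s = α / (128 * Real.log (k / β)) := by
  simp only [Program.scale, RealExpr.eval, NatExpr.eval, h1, h0, h5]
  simp

/-- For `α < 1` both the list length and the `O(1 / α)` rounding steps are dominated by `m / α ^ 2`;
for `α ≥ 1` the work is constant. -/
theorem time_le {α : ℝ} (hα : 0 < α) {m len : ℕ} (hlen : len ≤ m) (hm : 2 ≤ m) :
    ((100 + if α < 1 then len * 200 + (max 1 ⌈1 / (α / 16)⌉₊) * 60 + 700 else 0 : ℕ) : ℝ) ≤
      2000 * (1 + m / α ^ 2) := by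
  have hm' : (2 : ℝ) ≤ m := by exact_mod_cast hm
  split_ifs with h
  · have h1 : 1 / α ≤ 1 / α ^ 2 := by
      apply one_div_le_one_div_of_le (by positivity)
      nlinarith
    have h2 : 1 ≤ 1 / α := by rw [le_div_iff₀ hα]; linarith
    have h3 : ((max 1 ⌈1 / (α / 16)⌉₊ : ℕ) : ℝ) ≤ 16 * (1 / α) + 1 := by
      rw [Nat.cast_max, Nat.cast_one]
      refine max_le (by linarith) ?_
      have := (Nat.ceil_lt_add_one (a := 1 / (α / 16)) (by positivity)).le
      have e : 1 / (α / 16) = 16 * (1 / α) := by field_simp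
      rwa [e] at this ⊢
    have h4 : (len : ℝ) ≤ m := by exact_mod_cast hlen
    have h5 : (m : ℝ) / α ^ 2 = m * (1 / α ^ 2) := by ring
    push_cast at h3 ⊢
    rw [h5]
    have h6 : (m : ℝ) ≤ m * (1 / α ^ 2) := by nlinarith
    have h7 : 2 * (1 / α ^ 2) ≤ m * (1 / α ^ 2) :=
      mul_le_mul_of_nonneg_right hm' (by positivity)
    linarith
  · have : 0 ≤ (m : ℝ) / α ^ 2 := by positivity
    push_cast
    linarith

/-! ## Accuracy -/

/-- Distinct names are not needed: a repeated insertion writes the same value `v` again. -/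
theorem insertNew_apply {name : ℕ → ℕ} {v : ℝ} (h : ℕ → ℝ) (L x : ℕ) :
    insertNew name v h L x =
      if x ∈ (Finset.range L).image name ∧ ¬ 0 < h x then v else h x := by
  induction L with
  | zero => simp [insertNew]
  | succ L ih =>
    rw [insertNew]
    have hmem : x ∈ (Finset.range (L + 1)).image name ↔
        x = name L ∨ x ∈ (Finset.range L).image name := by
      rw [Finset.range_add_one, Finset.image_insert, Finset.mem_insert]
    split_ifs with h1 h2 h2
    · rw [ih]
      rcases hmem.1 h2.1 with rfl | h3
      · rw [ih] at h1
        split_ifs at h1 ⊢ with h4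
        · rfl
        · exact absurd h1 h2.2
      · rw [if_pos ⟨h3, h2.2⟩]
    · rw [ih, if_neg fun h3 => h2 ⟨hmem.2 (Or.inr h3.1), h3.2⟩]
    · rcases hmem.1 h2.1 with rfl | h3
      · rw [Function.update_self]
      · simp only [Function.update_apply, ih, h3, h2.2, not_false_eq_true, and_self, if_true, ite_self]
    · rw [Function.update_apply]
      have h3 : ¬ (x ∈ (Finset.range L).image name ∧ ¬ 0 < h x) :=
        fun h3 => h2 ⟨hmem.2 (Or.inr h3.1), h3.2⟩
      rw [ih, if_neg h3]
      split_ifs with h4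
      · subst h4
        rw [ih, if_neg h3] at h1
        exact absurd ⟨hmem.2 (Or.inl rfl), h1⟩ h2
      · rfl

theorem reweigh_of_forall_ne {name : ℕ → ℕ} (w : ℕ → ℝ) (η : ℝ) (h : ℕ → ℝ) {L x : ℕ}
    (hx : ∀ j < L, name j ≠ x) : reweigh name w η h L x = h x := by
  induction L with
  | zero => rfl
  | succ L ih =>
    rw [reweigh, Function.update_of_ne (hx L (Nat.lt_succ_self L)).symm,
      ih fun j hj => hx j (hj.trans (Nat.lt_succ_self L))]

/-- Unlike insertion, reweighing is multiplicative, and a repeated name would be reweighed twice;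
hence the injectivity. -/
theorem reweigh_name {name : ℕ → ℕ} (w : ℕ → ℝ) (η : ℝ) (h : ℕ → ℝ) {L : ℕ}
    (hinj : Set.InjOn name (Set.Iio L)) {j : ℕ} (hj : j < L) :
    reweigh name w η h L (name j) = h (name j) * Real.exp (η * w j) := by
  induction L with
  | zero => exact absurd hj (Nat.not_lt_zero j)
  | succ L ih =>
    have hinj' : Set.InjOn name (Set.Iio L) :=
      hinj.mono (Set.Iio_subset_Iio (Nat.le_succ L))
    rw [reweigh]
    rcases Nat.lt_succ_iff_lt_or_eq.1 hj with h1 | rfl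
    · rw [Function.update_of_ne, ih hinj' h1]
      intro h2
      exact h1.ne (hinj hj (Nat.lt_succ_self L) h2)
    · rw [Function.update_self, reweigh_of_forall_ne]
      intro i hi h2
      exact hi.ne (hinj (hi.trans hj) hj h2)

/-- The names that a query lists. -/
def RawQuery.support (q : RawQuery) : Finset ℕ := (Finset.range q.len).image q.name

/-- Passes from the list, indexed by positions, to a function on names extended by 0, in which form
queries with different lists can be compared on the common set `T`. -/
theorem RawQuery.Valid.exists_fun {q : RawQuery} {m : ℕ} (hq : q.Valid m) :
    ∃ f : ℕ → ℝ, (∀ x, 0 ≤ f x) ∧ (∀ x, f x ≤ 1) ∧ (∀ x ∉ q.support, f x = 0) ∧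
      (∀ g : ℕ → ℝ, ∑ j ∈ Finset.range q.len, g (q.name j) * q.weight j =
        ∑ x ∈ q.support, g x * f x) ∧
      ∀ η h x, reweigh q.name q.weight η h q.len x = h x * Real.exp (η * f x) := by
  classical
  let f : ℕ → ℝ := fun x => if h : ∃ j < q.len, q.name j = x then q.weight h.choose else 0
  have hname : ∀ j < q.len, f (q.name j) = q.weight j := fun j hj => by
    have hex : ∃ i < q.len, q.name i = q.name j := ⟨j, hj, rfl⟩
    simp only [f, dif_pos hex]
    congr 1
    exact hq.injOn hex.choose_spec.1 hj hex.choose_spec.2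
  have hzero : ∀ x, (¬ ∃ j < q.len, q.name j = x) → f x = 0 := fun x hx => dif_neg hx
  refine ⟨f, fun x => ?_, fun x => ?_, fun x hx => hzero x ?_, fun g => ?_, fun η h x => ?_⟩
  · by_cases hx : ∃ j < q.len, q.name j = x
    · obtain ⟨j, hj, rfl⟩ := hx
      rw [hname j hj]; exact hq.weight_nonneg j
    · rw [hzero x hx]
  · by_cases hx : ∃ j < q.len, q.name j = x
    · obtain ⟨j, hj, rfl⟩ := hx
      rw [hname j hj]; exact hq.weight_le j
    · rw [hzero x hx]; exact zero_le_one
  · rintro ⟨j, hj, rfl⟩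
    exact hx (Finset.mem_image_of_mem _ (Finset.mem_range.2 hj))
  · rw [RawQuery.support, Finset.sum_image (by simpa using hq.injOn)]
    exact Finset.sum_congr rfl fun j hj => by rw [hname j (Finset.mem_range.1 hj)]
  · by_cases hx : ∃ j < q.len, q.name j = x
    · obtain ⟨j, hj, rfl⟩ := hx
      rw [reweigh_name _ _ _ hq.injOn hj, hname j hj]
    · rw [hzero x hx, mul_zero, Real.exp_zero, mul_one]
      exact reweigh_of_forall_ne _ _ _ fun j hj h => hx ⟨j, hj, h⟩

/-! ### Rounding error and the entropy potential -/

namespace Config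

variable (c : Config)

theorem min_le_level_quant (z : ℝ) : min z 1 ≤ c.level (c.quant z) := by
  have := c.α_pos
  rw [Config.level, ← div_le_iff₀ (by positivity)]
  exact (Nat.le_ceil _).trans (Nat.cast_le.2 (le_max_right _ _))

theorem level_quant_lt {z : ℝ} (hz : c.quant z ≠ 1) :
    c.level (c.quant z) < min z 1 + c.α / 16 := by
  have hα := c.α_pos
  have h0 : 1 < ⌈min z 1 / (c.α / 16)⌉₊ := by
    by_contra hcon
    exact hz (max_eq_left (not_lt.1 hcon))
  have h1 : c.quant z = ⌈min z 1 / (c.α / 16)⌉₊ := max_eq_right h0.le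
  have h2 : 0 ≤ min z 1 / (c.α / 16) := by
    by_contra hcon
    rw [Nat.ceil_eq_zero.2 (not_le.1 hcon).le] at h0
    omega
  have h3 := Nat.ceil_lt_add_one h2
  rw [h1, Config.level]
  have h4 : (min z 1 / (c.α / 16) + 1) * (c.α / 16) = min z 1 + c.α / 16 := by field_simp
  rw [← h4]
  exact mul_lt_mul_of_pos_right h3 (by positivity)

/-- Noise `α / 64` and rounding `α / 16` add up to less than `α / 8`. The bounds on `y` make the
cut-off at 1 and the least level `α / 16` harmless. -/
theorem abs_level_quant_sub_le {z y : ℝ} (hy0 : 0 ≤ y) (hy1 : y ≤ 1) (hz : |z - y| ≤ c.α / 64) :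
    |c.level (c.quant z) - y| ≤ c.α / 8 := by
  have hα := c.α_pos
  have h1 := c.min_le_level_quant z
  have h2 := abs_le.1 hz
  rw [abs_le]
  constructor
  · rcases min_choice z 1 with h | h <;> rw [h] at h1 <;> linarith
  · by_cases h3 : c.quant z = 1
    · rw [h3, Config.level]; push_cast; linarith
    · have := c.level_quant_lt h3
      linarith [min_le_left z 1]

/-- The contribution of an element to the relative entropy of the database with respect to the
hypothesis. -/
def entropy (d h : ℝ) : ℝ := d * (Real.log d - Real.log h) - d + h

theorem entropy_nonneg {d h : ℝ} (hd : 0 ≤ d) (hh : 0 < h) : 0 ≤ entropy d h := by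
  unfold entropy
  rcases hd.eq_or_lt with rfl | hd
  · simpa using hh.le
  · have h1 := Real.one_sub_inv_le_log_of_pos (div_pos hd hh)
    rw [Real.log_div hd.ne' hh.ne', inv_div] at h1
    have h2 := mul_le_mul_of_nonneg_left h1 hd.le
    have h3 : d * (1 - h / d) = d - h := by field_simp
    linarith

/-- The potential argument: `T` is the set of elements with positive weight, and the entropy and the
number of updates are paid for by the mass of the database on `T`. -/
structure Invariant (d : ℕ → ℝ) (σ : State) (T : Finset ℕ) : Prop where
  pos : ∀ x ∈ T, 0 < σ.hyp x
  zero : ∀ x ∉ T, σ.hyp x = 0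
  potential : ∑ x ∈ T, entropy (d x) (σ.hyp x) + c.α ^ 2 / 128 * σ.updates ≤
    (∑ x ∈ T, d x) * (Real.log (2 * c.m) + 4)

variable {c} {d : ℕ → ℝ} {σ : State} {T : Finset ℕ}

theorem Invariant.pos_iff (h : c.Invariant d σ T) (x : ℕ) : 0 < σ.hyp x ↔ x ∈ T := by
  refine ⟨fun hx => ?_, h.pos x⟩
  by_contra hcon
  exact hx.ne' (h.zero x hcon)

/-- The entropy is nonnegative and the mass on `T` at most 1, so `α ^ 2 / 128 * updates ≤ log (2 m)
+ 4 = O(log m)`. The spare update serves the first test of the last round, whose noise is not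
controlled. -/
theorem Invariant.updates_add_one_lt (h : c.Invariant d σ T) (hd0 : ∀ x, 0 ≤ d x)
    (hd1 : ∀ T : Finset ℕ, ∑ x ∈ T, d x ≤ 1) (hm : 2 ≤ c.m) (hα : c.α < 1) :
    (σ.updates : ℝ) + 1 < c.budget := by
  have hα0 := c.α_pos
  have hm' : (2 : ℝ) ≤ c.m := by exact_mod_cast hm
  have h1 : 0 ≤ ∑ x ∈ T, entropy (d x) (σ.hyp x) :=
    Finset.sum_nonneg fun x hx => entropy_nonneg (hd0 x) (h.pos x hx)
  have hlog2 : Real.log 2 ≤ Real.log c.m := Real.log_le_log two_pos hm'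
  have hl2 := Real.log_two_gt_d9
  have h2 : Real.log (2 * c.m) = Real.log 2 + Real.log c.m :=
    Real.log_mul two_ne_zero (by positivity)
  have h3 : (∑ x ∈ T, d x) * (Real.log (2 * c.m) + 4) ≤ 1 * (Real.log (2 * c.m) + 4) :=
    mul_le_mul_of_nonneg_right (hd1 T) (by rw [h2]; linarith)
  have h4 := h.potential
  have h5 : c.α ^ 2 ≤ 1 := by nlinarith
  rw [Config.budget, lt_div_iff₀ (by positivity)]
  nlinarith

theorem Invariant.active (h : c.Invariant d σ T) (hd0 : ∀ x, 0 ≤ d x)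
    (hd1 : ∀ T : Finset ℕ, ∑ x ∈ T, d x ≤ 1) (hm : 2 ≤ c.m) (hα : c.α < 1) : c.Active σ :=
  ⟨hα, (lt_add_one _).trans (h.updates_add_one_lt hd0 hd1 hm hα)⟩

/-- Every new element has `d x ≤ 2 v` and weight `v / m`, so its logarithmic ratio is at most `log
(2 m)`; the at most `m` new weights sum to at most `v`. The excess `v + α ^ 2 / 128` is absorbed by
`5 μ ≥ 15 / 8 * v`: `4 μ` from the right-hand side and `μ` from the entropy. -/
theorem Invariant.insertNew (h : c.Invariant d σ T) (hd0 : ∀ x, 0 ≤ d x) {q : RawQuery}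
    (hq : q.Valid c.m) {v : ℝ} (hv : 0 < v) (hm : 2 ≤ c.m) (hα : c.α < 1) (hαv : c.α / 8 ≤ v)
    (hvd : 3 / 8 * v ≤ ∑ x ∈ q.support \ T, d x) (hdv : ∑ x ∈ q.support \ T, d x ≤ 2 * v) :
    c.Invariant d ⟨SparseRelease.insertNew q.name (v / c.m) σ.hyp q.len, σ.updates + 1, σ.answers⟩
      (T ∪ q.support) := by
  have hm' : (0 : ℝ) < c.m := by exact_mod_cast (by omega : 0 < c.m)
  have hvm : 0 < v / c.m := by positivity
  have hα0 := c.α_pos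
  have hins : ∀ x, SparseRelease.insertNew q.name (v / c.m) σ.hyp q.len x =
      if x ∈ q.support ∧ ¬ 0 < σ.hyp x then v / c.m else σ.hyp x :=
    fun x => insertNew_apply σ.hyp q.len x
  have hT : ∀ x ∈ T, SparseRelease.insertNew q.name (v / c.m) σ.hyp q.len x = σ.hyp x :=
    fun x hx => by rw [hins, if_neg fun h' => h'.2 (h.pos x hx)]
  have hN : ∀ x ∈ q.support \ T,
      SparseRelease.insertNew q.name (v / c.m) σ.hyp q.len x = v / c.m := fun x hx => by
    rw [Finset.mem_sdiff] at hx
    rw [hins, if_pos ⟨hx.1, by rw [h.pos_iff]; exact hx.2⟩]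
  have hdisj : Disjoint T (q.support \ T) := Finset.disjoint_sdiff
  have hunion : T ∪ q.support = T ∪ (q.support \ T) := by simp
  rw [hunion]
  refine ⟨fun x hx => ?_, fun x hx => ?_, ?_⟩
  · rcases Finset.mem_union.1 hx with hx | hx
    · simp only [hT x hx]; exact h.pos x hx
    · simp only [hN x hx]; exact hvm
  · rw [← hunion, Finset.mem_union, not_or] at hx
    simp only [hins]
    rw [if_neg fun h' => hx.2 h'.1]
    exact h.zero x hx.1
  · rw [Finset.sum_union hdisj, Finset.sum_union hdisj]
    set μ := ∑ x ∈ q.support \ T, d x with hμ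
    simp only
    rw [Finset.sum_congr rfl fun x hx => by rw [hT x hx]]
    have hcard : ((q.support \ T).card : ℝ) ≤ c.m := by
      have h1 : (q.support \ T).card ≤ q.len :=
        (Finset.card_le_card Finset.sdiff_subset).trans
          (Finset.card_image_le.trans (Finset.card_range _).le)
      exact_mod_cast h1.trans hq.len_le
    have hsum : ∑ x ∈ q.support \ T, entropy (d x)
        (SparseRelease.insertNew q.name (v / c.m) σ.hyp q.len x) ≤
        μ * Real.log (2 * c.m) - μ + v := by
      calc _ ≤ ∑ x ∈ q.support \ T, (d x * Real.log (2 * c.m) - d x + v / c.m) := by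
            refine Finset.sum_le_sum fun x hx => ?_
            rw [hN x hx, entropy]
            rcases (hd0 x).eq_or_lt with h0 | h0
            · rw [← h0]; simp
            · have h1 : d x ≤ 2 * v :=
                (Finset.single_le_sum (f := d) (fun y _ => hd0 y) hx).trans hdv
              have h2 : Real.log (d x) - Real.log (v / c.m) ≤ Real.log (2 * c.m) := by
                rw [← Real.log_div h0.ne' hvm.ne']
                refine Real.log_le_log (by positivity) ?_
                rw [div_le_iff₀ hvm]
                have : 2 * (c.m : ℝ) * (v / c.m) = 2 * v := by field_simp
                rw [this]; exact h1
              linarith [mul_le_mul_of_nonneg_left h2 h0.le]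
        _ = μ * Real.log (2 * c.m) - μ + (q.support \ T).card * (v / c.m) := by
            rw [Finset.sum_add_distrib, Finset.sum_sub_distrib, ← Finset.sum_mul,
              Finset.sum_const, nsmul_eq_mul]
        _ ≤ μ * Real.log (2 * c.m) - μ + c.m * (v / c.m) := by gcongr
        _ = _ := by rw [mul_div_cancel₀ _ hm'.ne']
    have h1 := h.potential
    have h2 : c.α ^ 2 ≤ c.α := by nlinarith
    push_cast
    nlinarith

/-- Reweighing changes the entropy of `x` by `h * (exp (η * f) - 1) - η * d * f`, and `exp (η * f) ≤
1 + (η + η ^ 2) * f` because `f ^ 2 ≤ f`. No normalisation is involved, so elements outside the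
query are unaffected. -/
theorem Invariant.reweigh (h : c.Invariant d σ T) {q : RawQuery} {f : ℕ → ℝ} (hf0 : ∀ x, 0 ≤ f x) (hf1 : ∀ x, f x ≤ 1) {η : ℝ} (hη : |η| ≤ 1)
    (hre : ∀ h x, SparseRelease.reweigh q.name q.weight η h q.len x = h x * Real.exp (η * f x))
    (hdrop : (η + η ^ 2) * ∑ x ∈ T, σ.hyp x * f x - η * ∑ x ∈ T, d x * f x ≤ -(c.α ^ 2 / 128))
    (a : ℕ → ℝ) :
    c.Invariant d ⟨SparseRelease.reweigh q.name q.weight η σ.hyp q.len, σ.updates + 1, a⟩ T := by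
  refine ⟨fun x hx => ?_, fun x hx => ?_, ?_⟩
  · simp only [hre]
    exact mul_pos (h.pos x hx) (Real.exp_pos _)
  · simp only [hre]
    rw [h.zero x hx, zero_mul]
  · have hsum : ∑ x ∈ T, entropy (d x) (SparseRelease.reweigh q.name q.weight η σ.hyp q.len x) ≤
        ∑ x ∈ T, entropy (d x) (σ.hyp x) +
          ((η + η ^ 2) * ∑ x ∈ T, σ.hyp x * f x - η * ∑ x ∈ T, d x * f x) := by
      rw [Finset.mul_sum, Finset.mul_sum, ← Finset.sum_sub_distrib, ← Finset.sum_add_distrib]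
      refine Finset.sum_le_sum fun x hx => ?_
      have hx0 := h.pos x hx
      rw [hre, entropy, entropy, Real.log_mul hx0.ne' (Real.exp_pos _).ne', Real.log_exp]
      have h1 : |η * f x| ≤ 1 := by
        rw [abs_mul, abs_of_nonneg (hf0 x)]
        exact mul_le_one₀ hη (hf0 x) (hf1 x)
      have h2 : Real.exp (η * f x) ≤ 1 + (η + η ^ 2) * f x := by
        have h3 := exp_le_quadratic h1
        have h4 : f x ^ 2 ≤ f x := by nlinarith [hf0 x, hf1 x]
        nlinarith [mul_le_mul_of_nonneg_left h4 (sq_nonneg η)]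
      linarith [mul_le_mul_of_nonneg_left h2 hx0.le]
    have h1 := h.potential
    simp only
    push_cast
    linarith

section Steps

variable {query : ℕ → (ℕ → ℝ) → RawQuery} {i : ℕ} {u : unitInterval} {D : ℕ → ℕ}

theorem Invariant.newMass_eq (h : c.Invariant d σ T) {q : RawQuery} (hq : q.Valid c.m)
    (hd : ∀ x, d x = D x / c.n) :
    q.newMass σ.hyp D / c.n = ∑ x ∈ q.support \ T, d x := by
  rw [RawQuery.newMass, Finset.sum_div, Finset.sdiff_eq_filter, Finset.sum_filter,
    RawQuery.support, Finset.sum_image (by simpa using hq.injOn)]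
  refine Finset.sum_congr rfl fun j _ => ?_
  by_cases hj : q.name j ∈ T
  · rw [if_pos ((h.pos_iff _).2 hj), if_neg (not_not.2 hj), zero_div]
  · rw [if_neg (mt (h.pos_iff _).1 hj), if_pos hj, hd]

theorem Invariant.step_first (h : c.Invariant d σ T) (hd : ∀ x, d x = D x / c.n)
    (hd1 : ∀ T : Finset ℕ, ∑ x ∈ T, d x ≤ 1) (hm : 2 ≤ c.m) (hα : c.α < 1)
    (hq : (query i σ.answers).Valid c.m) (hu : |c.scale * lap u| ≤ c.α / 64) :
    ∃ T', c.Invariant d ((c.tests query).step (c.val query D) u (2 * i) σ) T' ∧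
      ∑ x ∈ (query i σ.answers).support \ T', d x ≤ c.α / 8 := by
  have hd0 : ∀ x, 0 ≤ d x := fun x => by rw [hd]; positivity
  have hα0 := c.α_pos
  have hact := h.active hd0 hd1 hm hα
  have e1 : 2 * i % 2 = 0 := by omega
  have e2 : 2 * i / 2 = i := by omega
  set q := query i σ.answers with hq'
  set μ := ∑ x ∈ q.support \ T, d x with hμ
  simp only [Tests.step, Config.tests, Config.val, e1, e2, if_true, if_pos hact, ← hq',
    h.newMass_eq hq hd, ← hμ]
  set z := μ + c.scale * lap u with hz
  have hzμ : z - μ = c.scale * lap u := by rw [hz]; ring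
  have hu' := abs_le.1 hu
  have hmin := c.min_le_level_quant z
  have hμ1 : μ ≤ 1 := hd1 _
  by_cases h1 : c.quant z = 1
  · simp only [h1, if_true]
    refine ⟨T, h, ?_⟩
    rw [h1, Config.level] at hmin
    rcases min_choice z 1 with h2 | h2 <;> rw [h2] at hmin <;> push_cast at hmin <;> linarith
  · have h0 : c.quant z ≠ 0 := (c.quant_pos z).ne'
    have h2 : 2 ≤ c.quant z := by omega
    simp only [h1, h0, if_false]
    -- An index of at least 2 gives `v ≥ α / 8`. The total error `α / 64 + α / 16 = 5 α / 64` is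
    -- then at most `5 v / 8`, which is the source of the factor `3 / 8`.
    have hlev : c.α / 8 ≤ c.level (c.quant z) := by
      have : (2 : ℝ) ≤ c.quant z := by exact_mod_cast h2
      rw [Config.level]; nlinarith
    have hlt := c.level_quant_lt h1
    refine ⟨_, h.insertNew hd0 hq (by linarith) hm hα hlev ?_ ?_, ?_⟩
    · linarith [min_le_left z 1]
    · rcases min_choice z 1 with h3 | h3 <;> rw [h3] at hmin <;> linarith
    · have : q.support \ (T ∪ q.support) = ∅ := by simp
      rw [this, Finset.sum_empty]; positivity

/-- Holds for any hypothesis whatever: the second test checks the hypothesis before letting it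
answer, with error at most `α / 2 + α / 8`. -/
theorem abs_total_sub_answer_le (hact : c.Active σ)
    (hy0 : 0 ≤ (query i σ.answers).total D / c.n) (hy1 : (query i σ.answers).total D / c.n ≤ 1)
    (hu : |c.scale * lap u| ≤ c.α / 64) :
    |(query i σ.answers).total D / c.n -
      ((c.tests query).step (c.val query D) u (2 * i + 1) σ).answers i| ≤ c.α := by
  have hα0 := c.α_pos
  have e1 : ¬ (2 * i + 1) % 2 = 0 := by omega
  have e2 : (2 * i + 1) / 2 = i := by omega
  simp only [Tests.step, Config.tests, Config.val, e1, e2, if_false, if_pos hact]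
  set y := (query i σ.answers).total D / c.n with hy
  set z := y + c.scale * lap u with hz
  have hlev := abs_le.1 (c.abs_level_quant_sub_le (z := z) hy0 hy1 (by rw [hz]; simpa using hu))
  by_cases h1 : |c.level (c.quant z) - (query i σ.answers).onHyp σ.hyp| ≤ c.α / 2
  · simp only [if_pos h1, if_true, Function.update_self]
    rw [abs_le] at h1 ⊢
    constructor <;> linarith [h1.1, h1.2]
  · have h0 : c.quant z ≠ 0 := (c.quant_pos z).ne'
    simp only [if_neg h1, h0, if_false, Function.update_self]
    rw [abs_le]; constructor <;> linarith

theorem updates_step_first_le :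
    ((c.tests query).step (c.val query D) u (2 * i) σ).updates ≤ σ.updates + 1 := by
  have e1 : 2 * i % 2 = 0 := by omega
  simp only [Tests.step, Config.tests, e1, if_true]
  split_ifs <;> simp

theorem answers_step_first :
    ((c.tests query).step (c.val query D) u (2 * i) σ).answers = σ.answers := by
  have e1 : 2 * i % 2 = 0 := by omega
  simp only [Tests.step, Config.tests, e1, if_true]
  split_ifs <;> rfl

theorem Invariant.step_second (h : c.Invariant d σ T) (hd : ∀ x, d x = D x / c.n)
    (hd1 : ∀ T : Finset ℕ, ∑ x ∈ T, d x ≤ 1) (hm : 2 ≤ c.m) (hα : c.α < 1)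
    (hq : (query i σ.answers).Valid c.m) (hu : |c.scale * lap u| ≤ c.α / 64)
    (hleft : ∑ x ∈ (query i σ.answers).support \ T, d x ≤ c.α / 8) :
    c.Invariant d ((c.tests query).step (c.val query D) u (2 * i + 1) σ) T := by
  have hd0 : ∀ x, 0 ≤ d x := fun x => by rw [hd]; positivity
  have hα0 := c.α_pos
  have hact := h.active hd0 hd1 hm hα
  have e1 : ¬ (2 * i + 1) % 2 = 0 := by omega
  have e2 : (2 * i + 1) / 2 = i := by omega
  set q := query i σ.answers with hq'
  obtain ⟨f, hf0, hf1, hfs, hfsum, hfre⟩ := hq.exists_fun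
  have htot : q.total D / c.n = ∑ x ∈ q.support, d x * f x := by
    rw [← hfsum, RawQuery.total, Finset.sum_div]
    exact Finset.sum_congr rfl fun j _ => by rw [hd]; ring
  have hhyp : q.onHyp σ.hyp = ∑ x ∈ T, σ.hyp x * f x := by
    rw [RawQuery.onHyp, hfsum]
    exact (Finset.sum_subset (Finset.subset_union_left (s₂ := T)) fun x _ hx => by
        rw [hfs x hx, mul_zero]).trans
      (Finset.sum_subset (Finset.subset_union_right (s₁ := q.support)) fun x _ hx => by
        rw [h.zero x hx, zero_mul]).symm
  have hsplit : ∑ x ∈ q.support, d x * f x =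
      ∑ x ∈ T, d x * f x + ∑ x ∈ q.support \ T, d x * f x := by
    rw [← Finset.sum_union Finset.disjoint_sdiff, Finset.union_sdiff_self_eq_union]
    exact Finset.sum_subset Finset.subset_union_right fun x _ hx => by rw [hfs x hx, mul_zero]
  have hrest0 : 0 ≤ ∑ x ∈ q.support \ T, d x * f x :=
    Finset.sum_nonneg fun x _ => mul_nonneg (hd0 x) (hf0 x)
  have hrest : ∑ x ∈ q.support \ T, d x * f x ≤ ∑ x ∈ q.support \ T, d x :=
    Finset.sum_le_sum fun x _ => mul_le_of_le_one_right (hd0 x) (hf1 x)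
  have hT0 : 0 ≤ ∑ x ∈ T, d x * f x :=
    Finset.sum_nonneg fun x _ => mul_nonneg (hd0 x) (hf0 x)
  have hT1 : ∑ x ∈ T, d x * f x ≤ 1 :=
    (Finset.sum_le_sum fun x _ => mul_le_of_le_one_right (hd0 x) (hf1 x)).trans (hd1 T)
  have hy1 : ∑ x ∈ q.support, d x * f x ≤ 1 :=
    (Finset.sum_le_sum fun x _ => mul_le_of_le_one_right (hd0 x) (hf1 x)).trans (hd1 _)
  simp only [Tests.step, Config.tests, Config.val, e1, e2, if_false, if_pos hact, ← hq', htot]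
  set y := ∑ x ∈ q.support, d x * f x with hy
  set z := y + c.scale * lap u with hz
  have hlev := abs_le.1 (c.abs_level_quant_sub_le (z := z) (y := y) (by linarith) hy1
    (by rw [hz]; simpa using hu))
  by_cases h1 : |c.level (c.quant z) - q.onHyp σ.hyp| ≤ c.α / 2
  · simp only [if_pos h1, if_true]
    exact ⟨h.pos, h.zero, h.potential⟩
  · have h0 : c.quant z ≠ 0 := (c.quant_pos z).ne'
    simp only [if_neg h1, h0, if_false]
    rw [not_le] at h1
    by_cases h2 : q.onHyp σ.hyp < c.level (c.quant z)
    · simp only [if_pos h2]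
      rw [abs_of_pos (by linarith)] at h1
      refine h.reweigh hf0 hf1 (by rw [abs_of_pos (by linarith)]; linarith) (hfre _) ?_ _
      rw [← hhyp]
      -- Of the gap `α / 2`, the noisy value may account for `α / 8` and the mass outside `T` for
      -- another `α / 8`. With `η = α / 8` the drop is at least `α ^ 2 / 32 - α ^ 2 / 64`.
      have h3 : c.α / 4 ≤ ∑ x ∈ T, d x * f x - q.onHyp σ.hyp := by linarith
      have h4 : q.onHyp σ.hyp ≤ 1 := by linarith
      nlinarith [mul_le_mul_of_nonneg_left h3 hα0.le,
        mul_le_mul_of_nonneg_left h4 (sq_nonneg c.α)]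
    · simp only [if_neg h2]
      rw [abs_of_nonpos (by linarith)] at h1
      refine h.reweigh hf0 hf1 (by rw [abs_neg, abs_of_pos (by linarith)]; linarith)
        (hfre _) ?_ _
      rw [← hhyp]
      -- Here the mass outside `T` only helps. The unnormalised hypothesis may exceed 1, so the
      -- quadratic term is split into a part times the gap, which still leaves `7 / 8` of the linear
      -- gain, and a part times the database value, which is at most 1.
      have h3 : 3 * c.α / 8 ≤ q.onHyp σ.hyp - ∑ x ∈ T, d x * f x := by linarith
      have h5 : c.α / 8 * (7 / 8) ≤ c.α / 8 - (c.α / 8) ^ 2 := by nlinarith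
      have h6 : c.α / 8 * (7 / 8) * (3 * c.α / 8) ≤
          (c.α / 8 - (c.α / 8) ^ 2) * (q.onHyp σ.hyp - ∑ x ∈ T, d x * f x) :=
        mul_le_mul h5 h3 (by positivity) (le_trans (by positivity) h5)
      nlinarith [mul_le_mul_of_nonneg_left hT1 (sq_nonneg (c.α / 8))]

end Steps

end Config

/-! ### Accuracy with high probability -/

theorem queryValue_mem_Icc {X : Type*} {m : ℕ} (Q : Query X m) (D : Multiset X) :
    queryValue Q.toFun D ∈ Set.Icc (0 : ℝ) 1 := by
  have h0 : 0 ≤ (D.map Q.toFun).sum := Multiset.sum_nonneg fun y hy => by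
    obtain ⟨x, _, rfl⟩ := Multiset.mem_map.1 hy
    exact (Q.mem_Icc x).1
  have h1 : (D.map Q.toFun).sum ≤ Multiset.card D := by
    have := Multiset.sum_le_card_nsmul (D.map Q.toFun) 1 fun y hy => by
      obtain ⟨x, _, rfl⟩ := Multiset.mem_map.1 hy
      exact (Q.mem_Icc x).2
    simpa using this
  exact ⟨div_nonneg h0 (Nat.cast_nonneg _), div_le_one_of_le₀ h1 (Nat.cast_nonneg _)⟩

section Queries

variable {X : Type*} [Encodable X] {m k : ℕ}

theorem Query.total_raw (Q : Query X m) (D : Multiset X) :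
    Q.raw.total (counts D) = (D.map Q.toFun).sum := by
  classical
  have h1 : Q.raw.total (counts D) = (Q.supp.map fun x => (D.count x : ℝ) * Q.toFun x).sum := by
    rw [RawQuery.total, Finset.sum_range, ← List.sum_ofFn]
    congr 1
    refine List.ext_getElem (by simp [Query.raw]) fun j hj hj' => ?_
    have hj'' : j < Q.supp.length := by simpa using hj'
    simp only [List.getElem_ofFn, List.getElem_map, Query.raw, Query.name, Query.weight]
    rw [List.getD_eq_getElem _ _ (by simpa using hj''),
      List.getD_eq_getElem _ _ (by simpa using hj''), List.getElem_map, List.getElem_map, counts,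
      Multiset.count_map_eq_count' _ _ Encodable.encode_injective]
  rw [h1, ← List.sum_toFinset _ Q.nodup, Finset.sum_multiset_map_count]
  simp only [nsmul_eq_mul]
  rw [Finset.sum_subset (Finset.subset_union_left (s₂ := D.toFinset)) fun x _ hx => ?_]
  · symm
    refine Finset.sum_subset Finset.subset_union_right fun x _ hx => ?_
    rw [Multiset.mem_toFinset] at hx
    rw [Multiset.count_eq_zero_of_notMem hx, Nat.cast_zero, zero_mul]
  · rw [List.mem_toFinset, Q.mem_supp] at hx
    rw [le_antisymm (not_lt.1 hx) (Q.mem_Icc x).1, mul_zero]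

theorem sum_counts_div_le_one (D : Multiset X) (T : Finset ℕ) :
    ∑ x ∈ T, (counts D x : ℝ) / (Multiset.card D : ℝ) ≤ 1 := by
  rw [← Finset.sum_div, ← Nat.cast_sum]
  refine div_le_one_of_le₀ ?_ (Nat.cast_nonneg _)
  exact_mod_cast (sum_count_le_card T (D.map Encodable.encode)).trans (by simp)

variable (c : Config)

/-- The first test of the last round, number `2 k - 2`, needs no noise bound: the invariant is not
needed after it, and whatever it does costs at most one update, for which the budget has room. -/
theorem Config.abs_queryValue_sub_le (hm : c.m = m) (hm2 : 2 ≤ m) {D : Multiset X}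
    (hD : Multiset.card D = c.n) (A : Adversary X m k) (ω : Coins)
    (hω : ∀ t < 2 * k, t + 2 ≠ 2 * k → |c.scale * lap (coin t ω)| ≤ c.α / 64) (i : Fin k) :
    |queryValue (c.mechanism D A ω i).1.toFun D - (c.mechanism D A ω i).2| ≤ c.α := by
  subst hm
  set σ := c.stateAt A.strategy (counts D) ω with hσ
  have hmech : c.mechanism D A ω = A.transcript (σ k).answers := rfl
  have hans : (c.mechanism D A ω i).2 = (σ (i + 1)).answers i := by
    rw [hmech]
    exact c.stateAt_answers _ _ _ i.2
  have hquery : A.strategy i (σ i).answers = (c.mechanism D A ω i).1.raw := by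
    rw [Adversary.strategy, dif_pos i.2, hmech]
    simp only [Adversary.transcript]
    congr 2
    funext j
    exact (c.stateAt_answers_congr _ _ _ i.2.le j.2).symm
  have hvalue : (A.strategy i (σ i).answers).total (counts D) / c.n =
      queryValue (c.mechanism D A ω i).1.toFun D := by
    rw [hquery, Query.total_raw, ← hD]; rfl
  have hIcc := queryValue_mem_Icc (c.mechanism D A ω i).1 D
  rw [hans, hσ, c.stateAt_succ, ← hσ]
  rcases lt_or_ge c.α 1 with hα | hα
  swap
  · have hact : ∀ σ, ¬ c.Active σ := fun σ h => (h.1.trans_le hα).false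
    rw [c.step_second_of_not_active _ _ (hact _)]
    simp only [Function.update_self]
    rw [sub_zero, abs_of_nonneg hIcc.1]
    exact hIcc.2.trans hα
  have hcoin0 : ∀ j, coin (2 * j) ω = ω (j, 0) := fun j => by
    rw [coin, show 2 * j / 2 = j by omega, show 2 * j % 2 = 0 by omega]
  have hcoin1 : ∀ j, coin (2 * j + 1) ω = ω (j, 1) := fun j => by
    rw [coin, show (2 * j + 1) / 2 = j by omega, show (2 * j + 1) % 2 = 1 by omega]
  set d : ℕ → ℝ := fun x => counts D x / c.n with hd
  have hd0 : ∀ x, 0 ≤ d x := fun x => by positivity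
  have hd1 : ∀ T : Finset ℕ, ∑ x ∈ T, d x ≤ 1 := fun T => by
    rw [hd, ← hD]; exact sum_counts_div_le_one D T
  have hinv : ∀ j < k, ∃ T, c.Invariant d (σ j) T := by
    intro j
    induction j with
    | zero =>
      intro _
      exact ⟨∅, by simp, fun _ _ => rfl, by simp [hσ, Config.stateAt, Tests.run, Config.start]⟩
    | succ j ih =>
      intro hj
      obtain ⟨T, hT⟩ := ih (by omega)
      obtain ⟨T', hT', hleft⟩ := hT.step_first (i := j) (query := A.strategy) (u := ω (j, 0))
        (D := counts D) (fun _ => rfl) hd1 hm2 hα (A.strategy_valid _ _)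
        (by rw [← hcoin0]; exact hω _ (by omega) (by omega))
      refine ⟨T', ?_⟩
      rw [hσ, c.stateAt_succ]
      refine hT'.step_second (fun _ => rfl) hd1 hm2 hα (A.strategy_valid _ _)
        (by rw [← hcoin1]; exact hω _ (by omega) (by omega)) ?_
      rw [Config.answers_step_first]
      exact hleft
  obtain ⟨T, hT⟩ := hinv i i.2
  have h2 := hT.updates_add_one_lt hd0 hd1 hm2 hα
  have hact : c.Active ((c.tests A.strategy).step (c.val A.strategy (counts D)) (ω (i, 0))
      (2 * i) (σ i)) := by
    refine ⟨hα, lt_of_le_of_lt ?_ h2⟩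
    exact_mod_cast Config.updates_step_first_le
  have hfinal := Config.abs_total_sub_answer_le (c := c) (query := A.strategy) (i := i)
    (u := ω (i, 1)) (D := counts D) hact
  rw [Config.answers_step_first, hvalue] at hfinal
  exact hfinal hIcc.1 hIcc.2 (by rw [← hcoin1]; exact hω _ (by omega) (by omega))

theorem coinMeasure_lap_le {r : ℝ} (hr : 0 ≤ r) (t : ℕ) :
    coinMeasure {ω | r < |lap (coin t ω)|} ≤ ENNReal.ofReal (Real.exp (-r)) := by
  have hm : MeasurableSet {u : unitInterval | r < |lap u|} :=
    measurableSet_lt measurable_const measurable_lap_coe.abs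
  have h := lap_tail hr
  rw [← map_coin t, Measure.map_apply (measurable_coin t) hm] at h
  exact h

/-- Union bound at threshold `2 log (k / β)`, so each test fails with probability at most `(β / k) ^
2`. As `log (k / β)` can be arbitrarily close to 0, a constant factor cannot be hidden in it.
Leaving out one test makes the count `2 k - 1 ≤ k ^ 2`, which suffices even for `k = 1`. -/
theorem Config.isAccurate_mechanism (hm : c.m = m) (hm2 : 2 ≤ m) (hk : 1 ≤ k) {β : ℝ}
    (hβ : 0 < β) (hβ1 : β < 1) (hscale : c.scale = c.α / (128 * Real.log (k / β))) :
    IsAccurate c.n c.α β (c.mechanism (X := X) (m := m) (k := k)) := by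
  intro A D hD
  have hα := c.α_pos
  have hk' : (1 : ℝ) ≤ k := by exact_mod_cast hk
  have hL : 0 < Real.log (k / β) := Real.log_pos (by rw [lt_div_iff₀ hβ]; linarith)
  set r := 2 * Real.log (k / β) with hr
  have hexp : Real.exp (-r) = (β / k) ^ 2 := by
    have : -r = Real.log ((β / k) ^ 2) := by
      rw [Real.log_pow, hr, ← inv_div (k : ℝ) β, Real.log_inv]; push_cast; ring
    rw [this, Real.exp_log (by positivity)]
  set good := {ω | ∀ i, |queryValue (c.mechanism D A ω i).1.toFun D - (c.mechanism D A ω i).2| ≤ c.α}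
  set I := (Finset.range (2 * k)).erase (2 * k - 2) with hI
  have hcover : (Set.univ : Set Coins) ⊆ good ∪ ⋃ t ∈ I, {ω | r < |lap (coin t ω)|} := by
    intro ω _
    by_cases h : ∃ t ∈ I, r < |lap (coin t ω)|
    · right
      simpa using h
    · left
      push Not at h
      intro i
      refine c.abs_queryValue_sub_le hm hm2 hD A ω (fun t ht ht' => ?_) i
      have h1 := h t (by rw [hI, Finset.mem_erase, Finset.mem_range]; omega)
      rw [abs_mul, abs_of_pos c.scale_pos, hscale]
      calc c.α / (128 * Real.log (k / β)) * |lap (coin t ω)|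
          ≤ c.α / (128 * Real.log (k / β)) * (2 * Real.log (k / β)) := by gcongr
        _ = c.α / 64 := by field_simp; norm_num
  have hcard : I.card = 2 * k - 1 := by
    rw [hI, Finset.card_erase_of_mem (by rw [Finset.mem_range]; omega), Finset.card_range]
  have hbad : coinMeasure (⋃ t ∈ I, {ω | r < |lap (coin t ω)|}) ≤ ENNReal.ofReal β := by
    refine (measure_biUnion_finset_le I _).trans ?_
    refine (Finset.sum_le_sum fun t _ => coinMeasure_lap_le (by positivity : 0 ≤ r) t).trans ?_
    rw [Finset.sum_const, hcard, hexp, nsmul_eq_mul, ← ENNReal.ofReal_natCast,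
      ← ENNReal.ofReal_mul (Nat.cast_nonneg _)]
    refine ENNReal.ofReal_le_ofReal ?_
    rw [Nat.cast_sub (by omega)]
    push_cast
    rw [div_pow, mul_div_assoc', div_le_iff₀ (by positivity)]
    have h1 : (2 * (k : ℝ) - 1) * β ^ 2 ≤ k ^ 2 * β ^ 2 :=
      mul_le_mul_of_nonneg_right (by nlinarith [sq_nonneg ((k : ℝ) - 1)]) (sq_nonneg β)
    have h2 : (k : ℝ) ^ 2 * β ^ 2 ≤ k ^ 2 * β :=
      mul_le_mul_of_nonneg_left (by nlinarith) (sq_nonneg _)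
    linarith
  have h1 : 1 ≤ coinMeasure good + ENNReal.ofReal β := by
    rw [← measure_univ (μ := coinMeasure)]
    exact (measure_mono hcover).trans ((measure_union_le _ _).trans (by gcongr))
  rw [ENNReal.ofReal_sub _ hβ.le, ENNReal.ofReal_one]
  exact tsub_le_iff_right.2 h1

/-- For `α ≥ 1` no test is active, so the run does not depend on the database. Privacy in this range
needs its own argument, since the bound on the squared losses uses `α < 1`. -/
theorem Config.run_eq_of_one_le (hα : 1 ≤ c.α) (query : ℕ → (ℕ → ℝ) → RawQuery)
    (val val' : ℕ → State → ℝ) (ω : Coins) (n t : ℕ) (σ : State) :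
    (c.tests query).run val ω n t σ = (c.tests query).run val' ω n t σ := by
  induction n generalizing t σ with
  | zero => rfl
  | succ n ih =>
    have hact : ¬ c.Active σ := fun h => (h.1.trans_le hα).false
    have hout : ∀ z, (c.tests query).out t σ z = 0 := fun z => by simp [Config.tests, hact]
    rw [Tests.run, Tests.run, ih, hout, hout]

theorem Config.isPrivate_mechanism_of_one_le [DecidableEq X] (hα : 1 ≤ c.α) {ε δ : ℝ}
    (hε : 0 < ε) : IsPrivate ε δ (c.mechanism (X := X) (m := m) (k := k)) := by
  intro A D D' _ S _
  have h : c.mechanism D A = c.mechanism D' A := by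
    funext ω
    rw [Config.mechanism, Config.mechanism, c.run_eq_of_one_le hα]
  rw [h]
  refine le_add_right (le_mul_of_one_le_left' ?_)
  rw [← ENNReal.ofReal_one]
  exact ENNReal.ofReal_le_ofReal (Real.one_le_exp hε.le)

end Queries

/-- The sum of the squared privacy losses of the tests is small. -/
theorem sq_loss_mul_log {m k n : ℕ} {ε δ β α : ℝ} (hε : 0 < ε) (hδ : 0 < δ) (hδ1 : δ < 1)
    (hβ : 0 < β) (hβ1 : β < 1) (hm : 2 ≤ m) (hk : 1 ≤ k) (hn : 1 ≤ n) (hα0 : 0 < α)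
    (hα : α = 1000 * (Real.log m ^ (1 / 4 : ℝ) *
      (Real.log (4 / δ) * Real.log (k / β)) ^ (1 / 2 : ℝ) / (ε * n) ^ (1 / 2 : ℝ))) :
    (Real.log (4 / δ) / ε * (1 / n / (α / (128 * Real.log (k / β))))) ^ 2 * Real.log m =
      16384 / 1000 ^ 4 * α ^ 2 := by
  have hlm : 0 < Real.log m := Real.log_pos (by exact_mod_cast hm)
  have hlδ : 0 < Real.log (4 / δ) := Real.log_pos (by rw [lt_div_iff₀ hδ]; linarith)
  have hk' : (1 : ℝ) ≤ k := by exact_mod_cast hk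
  have hlk : 0 < Real.log (k / β) := Real.log_pos (by rw [lt_div_iff₀ hβ]; linarith)
  have hn' : (0 : ℝ) < n := by exact_mod_cast hn
  have h4 : (Real.log m ^ (1 / 4 : ℝ)) ^ 4 = Real.log m := by
    rw [← Real.rpow_natCast, ← Real.rpow_mul hlm.le]; norm_num
  have h2 : ∀ x : ℝ, 0 < x → (x ^ (1 / 2 : ℝ)) ^ 4 = x ^ 2 := fun x hx => by
    rw [← Real.rpow_natCast, ← Real.rpow_mul hx.le, ← Real.rpow_natCast]; norm_num
  have hα4 : α ^ 4 = 1000 ^ 4 * (Real.log m * (Real.log (4 / δ) * Real.log (k / β)) ^ 2 /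
      (ε * n) ^ 2) := by
    rw [hα, mul_pow, div_pow, mul_pow, h4, h2 _ (by positivity), h2 _ (by positivity)]
  -- Only the fourth power of `α` is free of roots; the constant is `16384 = 128 ^ 2`.
  have e : α ^ 2 = α ^ 4 / α ^ 2 := by field_simp
  rw [e, hα4]
  field_simp
  norm_num

end

end SparseRelease

theorem mainTheorem1 :
    ∃ (P : SparseRelease.Prog) (C K : ℝ) (d : ℕ), 0 < C ∧ 0 < K ∧
      ∀ (X : Type*) [Encodable X] [DecidableEq X] (ε δ β α : ℝ) (m k n : ℕ),
        0 < ε → ε < 1 → 0 < δ → δ < 1 → 0 < β → β < 1 → 2 ≤ m → 1 ≤ k → 1 ≤ n →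
        α = C * (Real.log m ^ (1 / 4 : ℝ) *
          (Real.log (4 / δ) * Real.log (k / β)) ^ (1 / 2 : ℝ) / (ε * n) ^ (1 / 2 : ℝ)) →
        ∃ M : Multiset X → SparseRelease.Adversary X m k → SparseRelease.Coins →
            SparseRelease.Transcript X m k,
          (∀ D A, Measurable (M D A)) ∧
          (∀ D A ω, SparseRelease.Runs P ε δ β n D A ω
            (K * (1 + m / α ^ 2) * (1 + Real.log (1 + m / α ^ 2)) ^ d) (M D A ω)) ∧
          SparseRelease.IsPrivate ε δ M ∧
          SparseRelease.IsAccurate n α β M := by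
  -- The exponent 0 suffices: the running time needs no logarithmic factor.
  refine ⟨SparseRelease.Program.main, 1000, 2000, 0, by norm_num, by norm_num, ?_⟩
  intro X _ _ ε δ β α m k n hε hε1 hδ hδ1 hβ hβ1 hm hk hn hα
  have hlm : 0 < Real.log m := Real.log_pos (by exact_mod_cast hm)
  have hlδ : 0 < Real.log (4 / δ) := Real.log_pos (by rw [lt_div_iff₀ hδ]; linarith)
  have hk' : (1 : ℝ) ≤ k := by exact_mod_cast hk
  have hlk : 0 < Real.log (k / β) := Real.log_pos (by rw [lt_div_iff₀ hβ]; linarith)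
  have hn' : (0 : ℝ) < n := by exact_mod_cast hn
  have hα0 : 0 < α := by rw [hα]; positivity
  let c : SparseRelease.Config :=
    ⟨α, α / (128 * Real.log (k / β)), m, n, hα0, by positivity⟩
  refine ⟨c.mechanism, c.measurable_mechanism, fun D A ω => ?_, ?_, ?_⟩
  · refine SparseRelease.runs_main c rfl rfl (fun s h1 h0 => ?_) (fun s h1 h0 h5 => ?_)
      (fun len hlen => ?_) D A ω
    · rw [SparseRelease.accuracy_eval hε hδ hδ1 hβ hβ1 hm hk hn h1 h0, ← hα]
    · exact SparseRelease.scale_eval h1 h0 h5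
    · rw [pow_zero, mul_one]
      exact SparseRelease.time_le hα0 hlen hm
  · rcases lt_or_ge α 1 with h1 | h1
    · have hsq := SparseRelease.sq_loss_mul_log hε hδ hδ1 hβ hβ1 hm hk hn hα0 hα
      set u := Real.log (4 / δ) / ε * (1 / n / (α / (128 * Real.log (k / β)))) with hu
      have hm' : (2 : ℝ) ≤ m := by exact_mod_cast hm
      have hlog2 : Real.log 2 ≤ Real.log m := Real.log_le_log two_pos hm'
      have hl2 := Real.log_two_gt_d9
      have hα2 : α ^ 2 ≤ 1 := by nlinarith
      have hu2 : u ^ 2 ≤ 1 / 10 ^ 6 := by nlinarith [sq_nonneg u]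
      refine c.isPrivate_mechanism rfl hε hε1 hδ hδ1 ?_ ?_
      · change 144 * u ^ 2 ≤ 1
        linarith
      · change 72 * u ^ 2 * (2048 * Real.log m / (α * α) + 1) ≤ 1
        -- The factors `log m` and `α ^ 2` cancel, leaving an absolute constant; `C = 1000` makes it
        -- small enough for the factor 72.
        have e : u ^ 2 * (2048 * Real.log m / (α * α)) = 2048 * (16384 / 1000 ^ 4) := by
          have : u ^ 2 * (2048 * Real.log m / (α * α)) =
              2048 * (u ^ 2 * Real.log m) / (α * α) := by ring
          rw [this, hsq]
          field_simp
        linarith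
    · exact c.isPrivate_mechanism_of_one_le h1 hε
  · exact c.isAccurate_mechanism rfl hm hk hβ hβ1 rfl
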